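/- Let $f:(0,\infty)^2\to\mathbb R$ be a symmetric function of class $C^2$, i.e. $f(y_1,y_2)=f(y_2,y_1)$, such that $\frac{\partial f}{\partial y_1}\frac{\partial f}{\partial y_2}>0$ on $(0,\infty)^2$. Let $M_1,M_2\subset\mathbb R^3$ be two closed strictly convex surfaces of class $C^3$; that is, each $M_l$ is a regular $C^3$ surface which is the boundary of a compact convex set with nonempty interior, and all its principal curvatures (with the sign for which the unit sphere has principal curvatures $1$) are positive. Let $\kappa_1\ge\kappa_2$ denote the principal curvatures and let $\nu_{M_l}:M_l\to\mathbb S^2$ be the Gauss map (outer unit normal) of $M_l$, which is a bijection. If $$f\big(\kappa_1(\nu_{M_1}^{-1}(x)),\kappa_2(\nu_{M_1}^{-1}(x))\big)=f\big(\kappa_1(\nu_{M_2}^{-1}(x)),\kappa_2(\nu_{M_2}^{-1}(x))\big)\qquad\text{for all }x\in\mathbb S^2,$$ then $M_1$ and $M_2$ agree up to a translation: there is $a\in\mathbb R^3$ with $M_2=M_1+a$. -/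

import Mathlib

open Set Topology

/-- Euclidean three-space. -/
abbrev Space3 : Type := EuclideanSpace ℝ (Fin 3)

/-- `M` is an (embedded, boundaryless) regular surface of class `C^k`: near each of its points it
is the zero set of a `C^k` function whose differential does not vanish. -/
def IsRegularSurface (k : WithTop ℕ∞) (M : Set Space3) : Prop :=
  ∀ p ∈ M, ∃ (U : Set Space3) (g : Space3 → ℝ), IsOpen U ∧ p ∈ U ∧ ContDiffOn ℝ k g U ∧
    (∀ x ∈ U, fderiv ℝ g x ≠ 0) ∧ M ∩ U = {x ∈ U | g x = 0}

/-- `M` is a closed convex surface: the boundary of a compact convex set with interior points. -/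
def IsClosedConvexSurface (M : Set Space3) : Prop :=
  ∃ K : Set Space3, IsCompact K ∧ Convex ℝ K ∧ (interior K).Nonempty ∧ M = frontier K

/-- `n` is an outer unit normal of the convex surface `M` at `p`: it is a unit vector orthogonal
to the tangent space of `M` at `p`, and `M` lies in the half-space `⟪y - p, n⟫ ≤ 0`.
(For a regular surface, `tangentConeAt ℝ M p` is the tangent plane, the set of velocities at `p`
of the curves on `M` through `p`.) -/
def IsOuterUnitNormal (M : Set Space3) (p n : Space3) : Prop :=
  ‖n‖ = 1 ∧ (∀ v ∈ tangentConeAt ℝ M p, inner ℝ v n = 0) ∧ ∀ y ∈ M, inner ℝ (y - p) n ≤ 0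

open Classical in
/-- The Gauss map `ν_M` of a convex surface: the outer unit normal at each point of `M`
(it exists and is unique for a closed convex surface of class `C^1`; the value is `0` where no
outer unit normal exists). -/
noncomputable def gaussMap (M : Set Space3) (p : Space3) : Space3 :=
  if h : ∃ n, IsOuterUnitNormal M p n then h.choose else 0

/-- The inverse `ν_M⁻¹` of the Gauss map `ν_M : M → 𝕊²`. -/
noncomputable def inverseGaussMap (M : Set Space3) : Space3 → Space3 :=
  Function.invFunOn (gaussMap M) M

/-- The set of principal curvatures of `M` at `p`: the eigenvalues of the shape operator, i.e. of
the differential `dν_p : T_pM → T_pM` of the Gauss map along `M`. With the outer normal,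
the unit sphere has principal curvatures `1`. -/
def principalCurvatures (M : Set Space3) (p : Space3) : Set ℝ :=
  {κ | ∃ v ∈ tangentConeAt ℝ M p, v ≠ 0 ∧ fderivWithin ℝ (gaussMap M) M p v = κ • v}

/-- The larger principal curvature `κ₁`. -/
noncomputable def kappa1 (M : Set Space3) (p : Space3) : ℝ := sSup (principalCurvatures M p)

/-- The smaller principal curvature `κ₂`; it equals `κ₁` at an umbilic point. -/
noncomputable def kappa2 (M : Set Space3) (p : Space3) : ℝ := sInf (principalCurvatures M p)

/-- A closed strictly convex surface of class `C^k` (for `k ≥ 2`): a closed convex surface which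
is regular of class `C^k` and whose principal curvatures are all positive. -/
structure IsClosedStrictlyConvexSurface (k : WithTop ℕ∞) (M : Set Space3) : Prop where
  closedConvex : IsClosedConvexSurface M
  regular : IsRegularSurface k M
  curvature_pos : ∀ p ∈ M, ∀ κ ∈ principalCurvatures M p, 0 < κ

/-! Let `X₁`, `X₂` be the inverse Gauss maps of the two surfaces, extended to be homogeneous of
degree zero (`gaussParam`). Each is the gradient of a support function: its derivative `DX` at a
unit vector `x` is symmetric, kills `x`, and on the plane orthogonal to `x` has the principal radii
of curvature as eigenvalues. The surfaces are translates of each other exactly when `X = X₁ - X₂` is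
constant. After a change of sign, `f` becomes an increasing symmetric function of the radii, so
equality of the curvature functions makes `DX` solve a linear elliptic relation: if `DX` is
semidefinite on a tangent plane, then it vanishes there.

The key is a maximum principle for the components `⟪X, e⟫`, with `e` a fixed unit vector: on the
sphere they are maximal at one of the poles `±e` (`inner_sub_le_max_pole`). Away from the poles, the
derivative of `⟪X, e⟫` determines one row of the symmetric form `DX`, and the elliptic relation then
controls the remaining entry. Differentiating the curvature equation in the direction of `e`
therefore gives a second order elliptic inequality for `⟪X, e⟫` whose lower order terms are bounded
by its gradient. Adding the barrier `ε exp (l ⟪x, e⟫)` makes the inequality strict for large `l`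
(`exists_barrier_bound`).

To conclude (`sub_eq_const`), compare the values of `⟪X, e⟫` at the two poles. If they agree for
some `e`, the maximum principle for `e` and `-e` makes `⟪X, e⟫` constant; then `DX` has rank at most
one off the poles, hence is semidefinite, hence zero. If they never agree, connectedness of the
sphere makes the same pole win for every `e`. Up to exchanging the surfaces, `⟪X x, e⟫ ≤ ⟪X e, e⟫`
for all `x` and `e`, which forces `DX` to be positive semidefinite and so zero.

The rest is the passage from the surfaces to `X₁` and `X₂`: regularity and symmetry of the inverse
Gauss map, and the identification of the principal curvatures with the reciprocals of the
eigenvalues of its derivative. -/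

/-! ### Elliptic functions of the half sum and half difference of the radii. -/

/-- The hypotheses on a curvature function written in terms of the half sum `m` and the half
difference `q` of the two principal radii of curvature. -/
structure IsEllipticRadial (G : ℝ × ℝ → ℝ) : Prop where
  contDiffOn : ContDiffOn ℝ 2 G {p | |p.2| < p.1}
  even : ∀ m q, |q| < m → G (m, -q) = G (m, q)
  elliptic : ∀ p : ℝ × ℝ, |p.2| < p.1 → |fderiv ℝ G p (0, 1)| < fderiv ℝ G p (1, 0)

/-- The trace-free part of the derivative of `w ↦ G (w.1, ‖w.2‖)`. -/
noncomputable def axialGrad (G : ℝ × ℝ → ℝ) (w : ℝ × ℂ) : ℂ :=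
  (fderiv ℝ G (w.1, ‖w.2‖) (0, 1)) • (‖w.2‖⁻¹ • w.2)

/-- The derivative of `w ↦ G (w.1, ‖w.2‖)`. -/
noncomputable def radialFDeriv (G : ℝ × ℝ → ℝ) (w : ℝ × ℂ) : ℝ × ℂ →L[ℝ] ℝ :=
  (fderiv ℝ G (w.1, ‖w.2‖) (1, 0)) • ContinuousLinearMap.fst ℝ ℝ ℂ +
    (innerSL ℝ (axialGrad G w)).comp (ContinuousLinearMap.snd ℝ ℝ ℂ)

/-- Half sums and half differences of pairs of radii in `[r, R]`. -/
def radiiBox (r R : ℝ) : Set (ℝ × ℝ) := {p | r ≤ p.1 - |p.2| ∧ p.1 + |p.2| ≤ R}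

lemma isOpen_abs_lt : IsOpen {p : ℝ × ℝ | |p.2| < p.1} :=
  isOpen_lt (by fun_prop) (by fun_prop)

lemma radialFDeriv_apply (G : ℝ × ℝ → ℝ) (w d : ℝ × ℂ) :
    radialFDeriv G w d =
      fderiv ℝ G (w.1, ‖w.2‖) (1, 0) * d.1 + inner ℝ (axialGrad G w) d.2 := by
  simp [radialFDeriv]

lemma norm_axialGrad_le (G : ℝ × ℝ → ℝ) (w : ℝ × ℂ) :
    ‖axialGrad G w‖ ≤ |fderiv ℝ G (w.1, ‖w.2‖) (0, 1)| := by
  unfold axialGrad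
  rw [norm_smul, norm_smul, norm_inv, norm_norm, Real.norm_eq_abs]
  rcases eq_or_ne ‖w.2‖ 0 with h | h
  · simp [h]
  · rw [inv_mul_cancel₀ h, mul_one]

lemma isCompact_radiiBox (r R : ℝ) : IsCompact (radiiBox r R) := by
  have hc : IsClosed (radiiBox r R) :=
    (isClosed_le (f := fun _ : ℝ × ℝ => r) (g := fun p => p.1 - |p.2|)
      (by fun_prop) (by fun_prop)).inter
      (isClosed_le (f := fun p : ℝ × ℝ => p.1 + |p.2|) (g := fun _ => R)
        (by fun_prop) (by fun_prop))
  refine (isCompact_Icc (a := ((r, -(R - r)) : ℝ × ℝ)) (b := (R, R - r))).of_isClosed_subset hc ?_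
  rintro ⟨m, q⟩ ⟨h1, h2⟩
  simp only at h1 h2
  have := abs_nonneg q
  have := neg_abs_le q
  have := le_abs_self q
  simp only [mem_Icc, Prod.mk_le_mk]
  refine ⟨⟨?_, ?_⟩, ?_, ?_⟩ <;> linarith

lemma convex_radiiBox (r R : ℝ) : Convex ℝ (radiiBox r R) := by
  rintro ⟨m, q⟩ ⟨h1, h2⟩ ⟨m', q'⟩ ⟨h3, h4⟩ a b ha hb hab
  simp only at h1 h2 h3 h4
  have hn : |a * q + b * q'| ≤ a * |q| + b * |q'| := by
    refine (abs_add_le _ _).trans_eq ?_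
    rw [abs_mul, abs_mul, abs_of_nonneg ha, abs_of_nonneg hb]
  have c1 := mul_le_mul_of_nonneg_left h1 ha
  have c2 := mul_le_mul_of_nonneg_left h2 ha
  have c3 := mul_le_mul_of_nonneg_left h3 hb
  have c4 := mul_le_mul_of_nonneg_left h4 hb
  have cr : a * r + b * r = r := by rw [← add_mul, hab, one_mul]
  have cR : a * R + b * R = R := by rw [← add_mul, hab, one_mul]
  constructor <;>
    simp only [Prod.fst_add, Prod.snd_add, Prod.smul_fst, Prod.smul_snd, smul_eq_mul] <;>
    linarith

lemma radiiBox_subset {r R : ℝ} (hr : 0 < r) : radiiBox r R ⊆ {p | |p.2| < p.1} := by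
  rintro ⟨m, q⟩ ⟨h1, -⟩
  simp only [mem_ofPred_eq] at *
  linarith

namespace IsEllipticRadial

variable {G : ℝ × ℝ → ℝ} (hG : IsEllipticRadial G)
include hG

lemma hasFDerivAt {p : ℝ × ℝ} (hp : |p.2| < p.1) : HasFDerivAt G (fderiv ℝ G p) p :=
  ((hG.contDiffOn.contDiffAt (isOpen_abs_lt.mem_nhds hp)).differentiableAt
    (by norm_num)).hasFDerivAt

lemma contDiffOn_fderiv : ContDiffOn ℝ 1 (fderiv ℝ G) {p | |p.2| < p.1} :=
  hG.contDiffOn.fderiv_of_isOpen isOpen_abs_lt (by norm_num)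

/-- An even function of `q` has zero derivative at `q = 0`. This is what makes `G` composed with a
norm differentiable at umbilics. -/
lemma fderiv_axis {m : ℝ} (hm : 0 < m) : fderiv ℝ G (m, 0) (0, 1) = 0 := by
  have h0 : |((m, (0 : ℝ)) : ℝ × ℝ).2| < ((m, (0 : ℝ)) : ℝ × ℝ).1 := by simpa using hm
  have h1 : HasDerivAt (fun q : ℝ => G (m, q)) (fderiv ℝ G (m, 0) (0, 1)) 0 := by
    have hl : HasDerivAt (fun q : ℝ => ((m, q) : ℝ × ℝ)) (0, 1) 0 :=
      (hasDerivAt_const _ _).prodMk (hasDerivAt_id _)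
    exact (hG.hasFDerivAt h0).comp_hasDerivAt (0 : ℝ) hl
  have h2 : HasDerivAt (fun q : ℝ => G (m, -q)) (-(fderiv ℝ G (m, 0) (0, 1))) 0 := by
    have h1' : HasDerivAt (fun q : ℝ => G (m, q)) (fderiv ℝ G (m, 0) (0, 1)) (-0) := by simpa
    have h2 := h1'.scomp (0 : ℝ) (hasDerivAt_neg (0 : ℝ))
    rw [neg_one_smul] at h2
    exact h2
  have h3 : (fun q : ℝ => G (m, -q)) =ᶠ[𝓝 0] fun q => G (m, q) := by
    have : ∀ᶠ q : ℝ in 𝓝 0, |q| < m := by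
      have : Filter.Tendsto (fun q : ℝ => |q|) (𝓝 0) (𝓝 |(0 : ℝ)|) := continuous_abs.tendsto 0
      rw [abs_zero] at this
      exact this.eventually (gt_mem_nhds hm)
    filter_upwards [this] with q hq using hG.even m q hq
  have h4 := (h2.congr_of_eventuallyEq h3.symm).unique h1
  linarith

/-- Off the axis this is the chain rule. On the axis the norm is not differentiable, but its
contribution is multiplied by the vanishing derivative of `fderiv_axis`. -/
lemma hasFDerivAt_radial {w : ℝ × ℂ} (hw : ‖w.2‖ < w.1) :
    HasFDerivAt (fun w : ℝ × ℂ => G (w.1, ‖w.2‖)) (radialFDeriv G w) w := by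
  have hp : |((w.1, ‖w.2‖) : ℝ × ℝ).2| < ((w.1, ‖w.2‖) : ℝ × ℝ).1 := by simpa using hw
  have hd := hG.hasFDerivAt hp
  have hsplit : ∀ d : ℝ × ℝ, fderiv ℝ G (w.1, ‖w.2‖) d =
      fderiv ℝ G (w.1, ‖w.2‖) (1, 0) * d.1 + fderiv ℝ G (w.1, ‖w.2‖) (0, 1) * d.2 := by
    intro d
    have : d = d.1 • ((1 : ℝ), (0 : ℝ)) + d.2 • ((0 : ℝ), (1 : ℝ)) := by ext <;> simp
    conv_lhs => rw [this]
    rw [map_add, map_smul, map_smul, smul_eq_mul, smul_eq_mul]; ring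
  rcases eq_or_ne w.2 0 with h0 | h0
  · have hm : 0 < w.1 := by simpa [h0] using hw
    rw [h0, norm_zero] at hd hsplit
    rw [hasFDerivAt_iff_isLittleO_nhds_zero] at hd ⊢
    have ht : Filter.Tendsto (fun h : ℝ × ℂ => ((h.1, ‖h.2‖) : ℝ × ℝ)) (𝓝 0) (𝓝 0) := by
      have : Continuous (fun h : ℝ × ℂ => ((h.1, ‖h.2‖) : ℝ × ℝ)) := by fun_prop
      have h := this.tendsto 0
      rwa [Prod.fst_zero, Prod.snd_zero, norm_zero, Prod.mk_zero_zero] at h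
    have h1 := hd.comp_tendsto ht
    refine (h1.congr' ?_ Filter.EventuallyEq.rfl).trans_isBigO ?_
    · refine Filter.Eventually.of_forall fun h => ?_
      simp only [Function.comp]
      rw [radialFDeriv_apply, hsplit]
      simp [h0, axialGrad, hG.fderiv_axis hm]
    · refine Asymptotics.IsBigO.of_bound 1 (Filter.Eventually.of_forall fun h => ?_)
      simp [Prod.norm_def]
  · have hn : HasFDerivAt (fun w : ℝ × ℂ => ‖w.2‖)
        ((innerSL ℝ (‖w.2‖⁻¹ • w.2)).comp (ContinuousLinearMap.snd ℝ ℝ ℂ)) w := by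
      have h1 : HasFDerivAt (fun z : ℂ => ‖z‖) (innerSL ℝ (‖w.2‖⁻¹ • w.2)) w.2 := by
        have h2 : HasFDerivAt (fun z : ℂ => ‖z‖ ^ 2) (2 • innerSL ℝ w.2) w.2 :=
          (hasStrictFDerivAt_norm_sq w.2).hasFDerivAt
        have h3 := h2.sqrt (by positivity)
        have h4 : (fun z : ℂ => √(‖z‖ ^ 2)) = fun z => ‖z‖ := by
          ext z; exact Real.sqrt_sq (norm_nonneg z)
        rw [h4] at h3
        refine h3.congr_fderiv ?_
        have : ‖w.2‖ ≠ 0 := norm_ne_zero_iff.2 h0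
        rw [Real.sqrt_sq (norm_nonneg _)]
        refine ContinuousLinearMap.ext fun z => ?_
        rw [innerSL_apply_apply, real_inner_smul_left, smul_apply,
          smul_apply, innerSL_apply_apply, smul_eq_mul, nsmul_eq_mul]
        field_simp
        norm_num
      exact h1.comp w hasFDerivAt_snd
    have hc := hd.comp w (hasFDerivAt_fst.prodMk hn)
    refine hc.congr_fderiv ?_
    ext d
    · simp [radialFDeriv_apply]
    · rw [ContinuousLinearMap.comp_apply, ContinuousLinearMap.comp_apply,
        ContinuousLinearMap.comp_apply, radialFDeriv_apply, hsplit]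
      simp [axialGrad]
      ring

/-- Compactness of the box makes ellipticity uniform: `c` is the ellipticity constant and `C` bounds
the coefficients. -/
lemma exists_bounds {r R : ℝ} (hr : 0 < r) :
    ∃ c C : ℝ, 0 < c ∧ 0 < C ∧ ∀ w : ℝ × ℂ, (w.1, ‖w.2‖) ∈ radiiBox r R →
      c ≤ fderiv ℝ G (w.1, ‖w.2‖) (1, 0) - ‖axialGrad G w‖ ∧
        fderiv ℝ G (w.1, ‖w.2‖) (1, 0) ≤ C := by
  have hsub := radiiBox_subset (R := R) hr
  have hcont : ∀ v : ℝ × ℝ, ContinuousOn (fun p => fderiv ℝ G p v) (radiiBox r R) := fun v =>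
    (hG.contDiffOn_fderiv.continuousOn.mono hsub).clm_apply continuousOn_const
  rcases (radiiBox r R).eq_empty_or_nonempty with he | hne
  · exact ⟨1, 1, one_pos, one_pos, fun w hw => by simp [he] at hw⟩
  obtain ⟨p, hp, hmin⟩ := (isCompact_radiiBox r R).exists_isMinOn hne
    ((hcont (1, 0)).sub (hcont (0, 1)).abs)
  obtain ⟨p', hp', hmax⟩ := (isCompact_radiiBox r R).exists_isMaxOn hne (hcont (1, 0))
  refine ⟨_, _, sub_pos.2 (hG.elliptic p (hsub hp)),
    (abs_nonneg _).trans_lt (hG.elliptic p' (hsub hp')), fun w hw => ⟨?_, hmax hw⟩⟩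
  have h1 := hmin hw
  have h2 := norm_axialGrad_le G w
  simp only [mem_ofPred_eq, Pi.sub_apply] at h1
  linarith

/-- The direction `w.2 / ‖w.2‖` is singular at umbilics, with Lipschitz constant of order `1 /
‖w'.2‖`. The derivative of `G` in `q` vanishes on the axis and so is at most `K ‖w'.2‖`, which
compensates the singularity. -/
lemma exists_lipschitz {r R : ℝ} (hr : 0 < r) :
    ∃ C : ℝ, 0 < C ∧ ∀ w w' d : ℝ × ℂ, (w.1, ‖w.2‖) ∈ radiiBox r R →
      (w'.1, ‖w'.2‖) ∈ radiiBox r R →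
      |radialFDeriv G w d - radialFDeriv G w' d| ≤ C * ‖w - w'‖ * ‖d‖ := by
  have hsub := radiiBox_subset (R := R) hr
  obtain ⟨K, hK⟩ := (hG.contDiffOn_fderiv.mono hsub).exists_lipschitzOnWith one_ne_zero
    (convex_radiiBox r R) (isCompact_radiiBox r R)
  have hpart : ∀ v : ℝ × ℝ, ‖v‖ = 1 → ∀ p ∈ radiiBox r R, ∀ p' ∈ radiiBox r R,
      |fderiv ℝ G p v - fderiv ℝ G p' v| ≤ K * ‖p - p'‖ := fun v hv p hp p' hp' => by
    have h1 := hK.norm_sub_le hp hp'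
    have h2 := (fderiv ℝ G p - fderiv ℝ G p').le_opNorm v
    rw [hv, mul_one, sub_apply, Real.norm_eq_abs] at h2
    exact h2.trans h1
  have hp_le : ∀ w w' : ℝ × ℂ,
      ‖((w.1, ‖w.2‖) : ℝ × ℝ) - (w'.1, ‖w'.2‖)‖ ≤ ‖w - w'‖ := fun w w' => by
    simp only [Prod.norm_def, Prod.fst_sub, Prod.snd_sub]
    exact max_le_max le_rfl (abs_norm_sub_norm_le _ _)
  have hgrad : ∀ w w' : ℝ × ℂ, (w.1, ‖w.2‖) ∈ radiiBox r R → (w'.1, ‖w'.2‖) ∈ radiiBox r R →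
      ‖axialGrad G w - axialGrad G w'‖ ≤ 3 * K * ‖w - w'‖ := fun w w' hw hw' => by
    have hd2 : ‖w.2 - w'.2‖ ≤ ‖w - w'‖ := norm_snd_le (w - w')
    have hw'1 : 0 < w'.1 := (norm_nonneg _).trans_lt (by simpa using hsub hw')
    have hax : |fderiv ℝ G (w'.1, ‖w'.2‖) (0, 1)| ≤ K * ‖w'.2‖ := by
      have hmem : ((w'.1, (0 : ℝ)) : ℝ × ℝ) ∈ radiiBox r R := by
        obtain ⟨h1, h2⟩ := hw'
        simp only [abs_norm] at h1 h2
        have := norm_nonneg w'.2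
        constructor <;> simp <;> linarith
      have := hpart (0, 1) (by simp [Prod.norm_def]) _ hw' _ hmem
      rw [hG.fderiv_axis hw'1, sub_zero] at this
      simpa [Prod.norm_def] using this
    rcases eq_or_ne w.2 0 with h0 | h0
    · have h1 : axialGrad G w = 0 := by simp [axialGrad, h0]
      have h2 : ‖w'.2‖ ≤ ‖w - w'‖ := by simpa [h0] using hd2
      rw [h1, zero_sub, norm_neg]
      have hK0 := K.coe_nonneg
      calc _ ≤ _ := norm_axialGrad_le G w'
        _ ≤ K * ‖w'.2‖ := hax
        _ ≤ K * ‖w - w'‖ := by gcongr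
        _ ≤ 3 * K * ‖w - w'‖ := by
          have := mul_nonneg hK0 (norm_nonneg (w - w'))
          linarith
    · have hn : ‖w.2‖ ≠ 0 := norm_ne_zero_iff.2 h0
      have hunit : ‖‖w.2‖⁻¹ • w.2‖ = 1 := by
        rw [norm_smul, norm_inv, norm_norm, inv_mul_cancel₀ hn]
      have hdec : axialGrad G w - axialGrad G w' =
          (fderiv ℝ G (w.1, ‖w.2‖) (0, 1) - fderiv ℝ G (w'.1, ‖w'.2‖) (0, 1)) •
            (‖w.2‖⁻¹ • w.2) +
          fderiv ℝ G (w'.1, ‖w'.2‖) (0, 1) • (‖w.2‖⁻¹ • w.2 - ‖w'.2‖⁻¹ • w'.2) := by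
        unfold axialGrad; module
      have hdir : ‖w'.2‖ * ‖‖w.2‖⁻¹ • w.2 - ‖w'.2‖⁻¹ • w'.2‖ ≤ 2 * ‖w.2 - w'.2‖ := by
        rcases eq_or_ne w'.2 0 with h0' | h0'
        · simp [h0']
        have hn' : ‖w'.2‖ ≠ 0 := norm_ne_zero_iff.2 h0'
        have e1 : ‖w'.2‖ • (‖w.2‖⁻¹ • w.2 - ‖w'.2‖⁻¹ • w'.2) =
            (‖w'.2‖ - ‖w.2‖) • (‖w.2‖⁻¹ • w.2) + (w.2 - w'.2) := by
          have a1 : ‖w.2‖ • (‖w.2‖⁻¹ • w.2) = w.2 := by rw [smul_smul, mul_inv_cancel₀ hn, one_smul]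
          have a2 : ‖w'.2‖ • (‖w'.2‖⁻¹ • w'.2) = w'.2 := by
            rw [smul_smul, mul_inv_cancel₀ hn', one_smul]
          rw [smul_sub, sub_smul, a1, a2]; abel
        calc _ = ‖‖w'.2‖ • (‖w.2‖⁻¹ • w.2 - ‖w'.2‖⁻¹ • w'.2)‖ := by
              rw [norm_smul, norm_norm]
          _ ≤ ‖(‖w'.2‖ - ‖w.2‖) • (‖w.2‖⁻¹ • w.2)‖ + ‖w.2 - w'.2‖ := by
              rw [e1]; exact norm_add_le _ _
          _ = |‖w'.2‖ - ‖w.2‖| + ‖w.2 - w'.2‖ := by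
              rw [norm_smul, hunit, mul_one, Real.norm_eq_abs]
          _ ≤ _ := by
              have := abs_norm_sub_norm_le w'.2 w.2
              rw [norm_sub_rev] at this
              linarith
      have hK0 := K.coe_nonneg
      calc _ ≤ |fderiv ℝ G (w.1, ‖w.2‖) (0, 1) - fderiv ℝ G (w'.1, ‖w'.2‖) (0, 1)| * 1 +
            |fderiv ℝ G (w'.1, ‖w'.2‖) (0, 1)| * ‖‖w.2‖⁻¹ • w.2 - ‖w'.2‖⁻¹ • w'.2‖ := by
              rw [hdec]
              refine (norm_add_le _ _).trans_eq ?_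
              rw [norm_smul, hunit, norm_smul, Real.norm_eq_abs, Real.norm_eq_abs]
        _ ≤ K * ‖w - w'‖ * 1 + K * ‖w'.2‖ * ‖‖w.2‖⁻¹ • w.2 - ‖w'.2‖⁻¹ • w'.2‖ := by
              gcongr
              exact (hpart (0, 1) (by simp [Prod.norm_def]) _ hw _ hw').trans
                (by gcongr; exact hp_le w w')
        _ = K * ‖w - w'‖ + K * (‖w'.2‖ * ‖‖w.2‖⁻¹ • w.2 - ‖w'.2‖⁻¹ • w'.2‖) := by ring
        _ ≤ K * ‖w - w'‖ + K * (2 * ‖w - w'‖) := by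
              have := mul_le_mul_of_nonneg_left (hdir.trans
                (mul_le_mul_of_nonneg_left hd2 zero_le_two)) hK0
              linarith
        _ = _ := by ring
  -- The trace part contributes `K`, the trace-free part `3 * K`; the `1` only ensures strict
  -- positivity.
  refine ⟨4 * K + 1, by positivity, fun w w' d hw hw' => ?_⟩
  rw [radialFDeriv_apply, radialFDeriv_apply]
  have e : fderiv ℝ G (w.1, ‖w.2‖) (1, 0) * d.1 + inner ℝ (axialGrad G w) d.2 -
      (fderiv ℝ G (w'.1, ‖w'.2‖) (1, 0) * d.1 + inner ℝ (axialGrad G w') d.2) =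
      (fderiv ℝ G (w.1, ‖w.2‖) (1, 0) - fderiv ℝ G (w'.1, ‖w'.2‖) (1, 0)) * d.1 +
        inner ℝ (axialGrad G w - axialGrad G w') d.2 := by
    rw [inner_sub_left]; ring
  have h1 : |fderiv ℝ G (w.1, ‖w.2‖) (1, 0) - fderiv ℝ G (w'.1, ‖w'.2‖) (1, 0)| ≤
      K * ‖w - w'‖ :=
    (hpart (1, 0) (by simp [Prod.norm_def]) _ hw _ hw').trans (by gcongr; exact hp_le w w')
  have h2 : |d.1| ≤ ‖d‖ := norm_fst_le d
  have h3 : ‖d.2‖ ≤ ‖d‖ := norm_snd_le d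
  rw [e]
  calc _ ≤ |fderiv ℝ G (w.1, ‖w.2‖) (1, 0) - fderiv ℝ G (w'.1, ‖w'.2‖) (1, 0)| * |d.1| +
        ‖axialGrad G w - axialGrad G w'‖ * ‖d.2‖ := by
          refine (abs_add_le _ _).trans ?_
          rw [abs_mul]
          gcongr
          exact abs_real_inner_le_norm _ _
    _ ≤ K * ‖w - w'‖ * ‖d‖ + 3 * K * ‖w - w'‖ * ‖d‖ := by
          gcongr
          exact hgrad w w' hw hw'
    _ ≤ _ := by
          have := mul_nonneg (norm_nonneg (w - w')) (norm_nonneg d)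
          nlinarith

omit hG in
lemma radial_mem_of_segment {r R : ℝ} {w w' : ℝ × ℂ} (hw : (w.1, ‖w.2‖) ∈ radiiBox r R)
    (hw' : (w'.1, ‖w'.2‖) ∈ radiiBox r R) {x : ℝ × ℂ} (hx : x ∈ segment ℝ w w') :
    (x.1, ‖x.2‖) ∈ radiiBox r R := by
  obtain ⟨a, b, ha, hb, hab, rfl⟩ := hx
  obtain ⟨h1, h2⟩ := hw
  obtain ⟨h3, h4⟩ := hw'
  simp only [abs_norm] at h1 h2 h3 h4
  have hn : ‖a • w.2 + b • w'.2‖ ≤ a * ‖w.2‖ + b * ‖w'.2‖ := by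
    refine (norm_add_le _ _).trans_eq ?_
    rw [norm_smul, norm_smul, Real.norm_of_nonneg ha, Real.norm_of_nonneg hb]
  have c1 := mul_le_mul_of_nonneg_left h1 ha
  have c2 := mul_le_mul_of_nonneg_left h2 ha
  have c3 := mul_le_mul_of_nonneg_left h3 hb
  have c4 := mul_le_mul_of_nonneg_left h4 hb
  have cr : a * r + b * r = r := by rw [← add_mul, hab, one_mul]
  have cR : a * R + b * R = R := by rw [← add_mul, hab, one_mul]
  constructor <;>
    simp only [Prod.fst_add, Prod.snd_add, Prod.smul_fst, Prod.smul_snd, smul_eq_mul, abs_norm] <;>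
    linarith

/-- The linear elliptic relation satisfied by the difference of two solutions. -/
lemma exists_radialFDeriv_eq_zero {r R : ℝ} (hr : 0 < r) {w w' : ℝ × ℂ}
    (hw : (w.1, ‖w.2‖) ∈ radiiBox r R) (hw' : (w'.1, ‖w'.2‖) ∈ radiiBox r R)
    (heq : G (w.1, ‖w.2‖) = G (w'.1, ‖w'.2‖)) :
    ∃ x : ℝ × ℂ, (x.1, ‖x.2‖) ∈ radiiBox r R ∧ radialFDeriv G x (w - w') = 0 := by
  have hconv : Convex ℝ (segment ℝ w' w) := convex_segment _ _
  obtain ⟨x, hx, hxe⟩ := domain_mvt (f := fun w : ℝ × ℂ => G (w.1, ‖w.2‖))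
    (f' := radialFDeriv G) (s := segment ℝ w' w) (x := w') (y := w)
    (fun x hx => (hG.hasFDerivAt_radial (by
      simpa using radiiBox_subset hr (radial_mem_of_segment hw' hw hx))).hasFDerivWithinAt)
    hconv (left_mem_segment _ _ _) (right_mem_segment _ _ _)
  refine ⟨x, radial_mem_of_segment hw' hw hx, ?_⟩
  rw [← hxe]
  exact sub_eq_zero.2 heq

/-- The last hypothesis says that the form `w - w'` is positive semidefinite. The linear relation
bounds `c` times its half trace above by zero, so the form is zero. -/
lemma eq_of_norm_le {r R : ℝ} (hr : 0 < r) {w w' : ℝ × ℂ}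
    (hw : (w.1, ‖w.2‖) ∈ radiiBox r R) (hw' : (w'.1, ‖w'.2‖) ∈ radiiBox r R)
    (heq : G (w.1, ‖w.2‖) = G (w'.1, ‖w'.2‖)) (hle : ‖w.2 - w'.2‖ ≤ w.1 - w'.1) : w = w' := by
  obtain ⟨x, hx, h0⟩ := hG.exists_radialFDeriv_eq_zero hr hw hw' heq
  obtain ⟨c, C, hc, -, hcC⟩ := hG.exists_bounds (r := r) (R := R) hr
  have h1 := (hcC x hx).1
  rw [radialFDeriv_apply, Prod.fst_sub, Prod.snd_sub] at h0
  have h2 := (abs_le.1 (abs_real_inner_le_norm (axialGrad G x) (w.2 - w'.2))).1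
  have h3 := mul_le_mul_of_nonneg_left hle (norm_nonneg (axialGrad G x))
  have h4 := norm_nonneg (w.2 - w'.2)
  have h5 := mul_le_mul_of_nonneg_right h1 (h4.trans hle)
  have h6 : w.1 - w'.1 = 0 := by nlinarith
  have h7 : w.2 - w'.2 = 0 := norm_le_zero_iff.1 (h6 ▸ hle)
  exact Prod.ext (sub_eq_zero.1 h6) (sub_eq_zero.1 h7)

end IsEllipticRadial

/-! ### Quadratic forms on tangent planes and orthonormal frames. -/

/-- The quadratic form `p s² + 2 q s t + r t²`, split into half its trace and its trace-free
part. -/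
noncomputable def formPart (p q r : ℝ) : ℝ × ℂ := ((p + r) / 2, ⟨(p - r) / 2, q⟩)

/-- The eigenvalues of the form are the half trace plus and minus the norm of the trace-free part,
so the conclusion is nonnegativity of the smaller one. It is obtained from nonnegative trace and
determinant. -/
lemma norm_formPart_snd_le {p q r : ℝ}
    (h : ∀ s t : ℝ, s ^ 2 + t ^ 2 = 1 → 0 ≤ p * s ^ 2 + 2 * q * (s * t) + r * t ^ 2) :
    ‖(formPart p q r).2‖ ≤ (formPart p q r).1 := by
  have hall : ∀ s t : ℝ, 0 ≤ p * s ^ 2 + 2 * q * (s * t) + r * t ^ 2 := fun s t => by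
    rcases eq_or_lt_of_le (add_nonneg (sq_nonneg s) (sq_nonneg t)) with h0 | h0
    · have hs : s = 0 := by nlinarith [sq_nonneg s, sq_nonneg t]
      have ht : t = 0 := by nlinarith [sq_nonneg s, sq_nonneg t]
      simp [hs, ht]
    · set n := √(s ^ 2 + t ^ 2) with hn
      have hn2 : n ^ 2 = s ^ 2 + t ^ 2 := Real.sq_sqrt h0.le
      have hn0 : n ≠ 0 := (Real.sqrt_pos.2 h0).ne'
      have h1 := h (s / n) (t / n) (by field_simp; linarith)
      have h2 := mul_nonneg h1 (sq_nonneg n)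
      field_simp at h2
      linarith
  have hp : 0 ≤ p := by simpa using hall 1 0
  have hr : 0 ≤ r := by simpa using hall 0 1
  have hdet : q ^ 2 ≤ p * r := by
    -- The form takes the values `p (p r - q²)` at `(q, -p)` and `r (p r - q²)` at `(r, -q)`. The
    -- vectors `(±1, 1)` serve for the case `p = r = 0`.
    have h1 := hall q (-p)
    have h2 := hall r (-q)
    have h3 := hall (-1) 1
    have h4 := hall 1 1
    rcases hp.eq_or_lt with h0 | h0
    · rcases hr.eq_or_lt with h5 | h5
      · subst h0; rw [← h5] at *
        have : q = 0 := by linarith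
        simp [this]
      · nlinarith
    · nlinarith
  have hsq : ‖(formPart p q r).2‖ ^ 2 ≤ (formPart p q r).1 ^ 2 := by
    rw [← Complex.normSq_eq_norm_sq, Complex.normSq_apply]
    simp only [formPart]
    nlinarith
  exact abs_le_of_sq_le_sq' hsq (by simp only [formPart]; linarith) |>.2

lemma HasDerivAt.formPart {p q r : ℝ → ℝ} {p' q' r' s : ℝ} (hp : HasDerivAt p p' s)
    (hq : HasDerivAt q q' s) (hr : HasDerivAt r r' s) :
    HasDerivAt (fun s => formPart (p s) (q s) (r s)) (formPart p' q' r') s := by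
  have h1 : ∀ p q r : ℝ, _root_.formPart p q r =
      p • ((1 / 2, 1 / 2) : ℝ × ℂ) + q • ((0, Complex.I) : ℝ × ℂ) +
        r • ((1 / 2, -(1 / 2)) : ℝ × ℂ) := fun p q r => by
    refine Prod.ext ?_ (Complex.ext ?_ ?_) <;> simp [_root_.formPart] <;> ring
  simp only [h1]
  exact ((hp.smul_const _).add (hq.smul_const _)).add (hr.smul_const _)

/-- `x, a, b` is an orthonormal frame of space. -/
structure IsFrame (x a b : Space3) : Prop where
  norm_x : ‖x‖ = 1
  norm_a : ‖a‖ = 1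
  norm_b : ‖b‖ = 1
  inner_xa : inner ℝ x a = 0
  inner_xb : inner ℝ x b = 0
  inner_ab : inner ℝ a b = 0

/-- The restriction of the quadratic form of `W` to the plane of `a` and `b`. -/
noncomputable def planarForm (W : Space3 →L[ℝ] Space3) (a b : Space3) : ℝ × ℂ :=
  formPart (inner ℝ (W a) a) (inner ℝ (W a) b) (inner ℝ (W b) b)

lemma planarForm_sub (W W' : Space3 →L[ℝ] Space3) (a b : Space3) :
    planarForm (W - W') a b = planarForm W a b - planarForm W' a b := by
  refine Prod.ext ?_ (Complex.ext ?_ ?_) <;>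
    simp only [planarForm, formPart, sub_apply, inner_sub_left, Prod.fst_sub, Prod.snd_sub,
      Complex.sub_re, Complex.sub_im] <;> ring

lemma norm_planarForm_le (W : Space3 →L[ℝ] Space3) {a b : Space3} (ha : ‖a‖ = 1) (hb : ‖b‖ = 1) :
    ‖planarForm W a b‖ ≤ 2 * ‖W‖ := by
  have h : ∀ u v : Space3, ‖u‖ = 1 → ‖v‖ = 1 → |inner ℝ (W u) v| ≤ ‖W‖ := fun u v hu hv => by
    have h1 := abs_real_inner_le_norm (W u) v
    have h2 := W.le_opNorm u
    rw [hu, mul_one] at h2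
    rw [hv, mul_one] at h1
    exact h1.trans h2
  have h1 := abs_le.1 (h a a ha ha)
  have h2 := abs_le.1 (h a b ha hb)
  have h3 := abs_le.1 (h b b hb hb)
  have h0 := norm_nonneg W
  refine max_le ?_ ((Complex.norm_le_abs_re_add_abs_im _).trans ?_)
  · rw [Real.norm_eq_abs, abs_le]
    simp only [planarForm, formPart]
    constructor <;> linarith
  · have h4 : |(planarForm W a b).2.re| ≤ ‖W‖ := by
      rw [abs_le]; simp only [planarForm, formPart]; constructor <;> linarith
    have h5 : |(planarForm W a b).2.im| ≤ ‖W‖ := h a b ha hb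
    linarith

lemma IsFrame.expand {x a b : Space3} (h : IsFrame x a b) {d : Space3} (hd : inner ℝ x d = 0) :
    d = (inner ℝ a d : ℝ) • a + (inner ℝ b d : ℝ) • b := by
  have ho : Orthonormal ℝ ![x, a, b] := by
    rw [orthonormal_iff_ite]
    intro i j
    fin_cases i <;> fin_cases j <;>
      simp [h.norm_x, h.norm_a, h.norm_b, h.inner_xa, h.inner_xb, h.inner_ab,
        real_inner_comm x a, real_inner_comm x b, real_inner_comm a b]
  let B := (basisOfOrthonormalOfCardEqFinrank ho (by simp)).toOrthonormalBasis (by simpa using ho)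
  have hB : ∀ i, B i = ![x, a, b] i := fun i => by simp [B]
  have := B.sum_repr' d
  simp only [Fin.sum_univ_three, hB] at this
  simp only [Matrix.cons_val_zero, Matrix.cons_val_one, Matrix.cons_val, hd, zero_smul,
    zero_add] at this
  exact this.symm

lemma exists_isFrame {x a : Space3} (hx : ‖x‖ = 1) (ha : ‖a‖ = 1) (hxa : inner ℝ x a = 0) :
    ∃ b, IsFrame x a b := by
  have hne : (Submodule.span ℝ {x, a})ᗮ ≠ ⊥ := by
    intro h
    have h1 := (Submodule.span ℝ {x, a}).finrank_add_finrank_orthogonal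
    rw [h, finrank_bot, add_zero, finrank_euclideanSpace_fin] at h1
    have h2 := finrank_span_finset_le_card (R := ℝ) ({x, a} : Finset Space3)
    have h3 := Finset.card_le_two (a := x) (b := a)
    simp only [Finset.coe_insert, Finset.coe_singleton] at h2
    rw [Set.finrank, h1] at h2
    omega
  obtain ⟨b, hb, hb0⟩ := Submodule.exists_mem_ne_zero_of_ne_bot hne
  rw [Submodule.mem_orthogonal] at hb
  have h1 := hb x (Submodule.subset_span (by simp))
  have h2 := hb a (Submodule.subset_span (by simp))
  refine ⟨‖b‖⁻¹ • b, hx, ha, ?_, hxa, ?_, ?_⟩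
  · rw [norm_smul, norm_inv, norm_norm, inv_mul_cancel₀ (norm_ne_zero_iff.2 hb0)]
  · rw [real_inner_smul_right, h1, mul_zero]
  · rw [real_inner_smul_right, h2, mul_zero]

lemma IsFrame.norm_comb {x a b : Space3} (h : IsFrame x a b) {s t : ℝ} (hst : s ^ 2 + t ^ 2 = 1) :
    ‖s • a + t • b‖ = 1 := by
  have haa : inner ℝ a a = (1 : ℝ) := by rw [real_inner_self_eq_norm_sq, h.norm_a, one_pow]
  have hbb : inner ℝ b b = (1 : ℝ) := by rw [real_inner_self_eq_norm_sq, h.norm_b, one_pow]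
  have hba : inner ℝ b a = (0 : ℝ) := by rw [real_inner_comm]; exact h.inner_ab
  have : ‖s • a + t • b‖ ^ 2 = 1 := by
    rw [← real_inner_self_eq_norm_sq]
    simp only [inner_add_left, inner_add_right, real_inner_smul_left,
      real_inner_smul_right, haa, hbb, hba, h.inner_ab]
    linarith
  exact (pow_eq_one_iff_of_nonneg (norm_nonneg _) two_ne_zero).1 this

lemma IsFrame.inner_comb {x a b : Space3} (h : IsFrame x a b) (s t : ℝ) :
    inner ℝ x (s • a + t • b) = (0 : ℝ) := by
  simp [inner_add_right, real_inner_smul_right, h.inner_xa, h.inner_xb]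

lemma exists_unit_perp (x : Space3) : ∃ a : Space3, ‖a‖ = 1 ∧ inner ℝ x a = (0 : ℝ) := by
  have hne : (Submodule.span ℝ {x})ᗮ ≠ ⊥ := by
    intro h
    have h1 := (Submodule.span ℝ {x}).finrank_add_finrank_orthogonal
    rw [h, finrank_bot, add_zero, finrank_euclideanSpace_fin] at h1
    have h2 := finrank_span_le_card (R := ℝ) ({x} : Set Space3)
    simp only [Set.toFinset_singleton, Finset.card_singleton] at h2
    omega
  obtain ⟨b, hb, hb0⟩ := Submodule.exists_mem_ne_zero_of_ne_bot hne
  rw [Submodule.mem_orthogonal] at hb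
  refine ⟨‖b‖⁻¹ • b, ?_, ?_⟩
  · rw [norm_smul, norm_inv, norm_norm, inv_mul_cancel₀ (norm_ne_zero_iff.2 hb0)]
  · rw [real_inner_smul_right, hb x (Submodule.mem_span_singleton_self x), mul_zero]

/-! ### Great circles and the second derivative test. -/

/-- The great circle through `p` with initial velocity `a`. -/
noncomputable def greatCircle (p a : Space3) (s : ℝ) : Space3 := Real.cos s • p + Real.sin s • a

lemma greatCircle_zero (p a : Space3) : greatCircle p a 0 = p := by simp [greatCircle]

lemma hasDerivAt_greatCircle (p a : Space3) (s : ℝ) :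
    HasDerivAt (greatCircle p a) (greatCircle a (-p) s) s := by
  have := ((Real.hasDerivAt_cos s).smul_const p).add ((Real.hasDerivAt_sin s).smul_const a)
  refine this.congr_deriv ?_
  simp only [greatCircle]; module

lemma IsFrame.greatCircle {p a b : Space3} (h : IsFrame p a b) (s : ℝ) :
    IsFrame (greatCircle p a s) (greatCircle a (-p) s) b := by
  have h1 : inner ℝ p p = (1 : ℝ) := by rw [real_inner_self_eq_norm_sq, h.norm_x, one_pow]
  have h2 : inner ℝ a a = (1 : ℝ) := by rw [real_inner_self_eq_norm_sq, h.norm_a, one_pow]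
  have h3 := h.inner_xa
  have h4 : inner ℝ a p = (0 : ℝ) := by rw [real_inner_comm]; exact h3
  have hn : ∀ v : Space3, inner ℝ v v = (1 : ℝ) → ‖v‖ = 1 := fun v hv => by
    rw [real_inner_self_eq_norm_sq] at hv
    exact (pow_eq_one_iff_of_nonneg (norm_nonneg v) two_ne_zero).1 hv
  have hcs := Real.sin_sq_add_cos_sq s
  refine ⟨hn _ ?_, hn _ ?_, h.norm_b, ?_, ?_, ?_⟩ <;>
    simp only [_root_.greatCircle, inner_add_left, inner_add_right, real_inner_smul_left,
      real_inner_smul_right, inner_neg_left, inner_neg_right, h1, h2, h3, h4, h.inner_xb,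
      h.inner_ab] <;> nlinarith

lemma norm_greatCircle {p a : Space3} (hp : ‖p‖ = 1) (ha : ‖a‖ = 1) (hpa : inner ℝ p a = 0)
    (s : ℝ) : ‖greatCircle p a s‖ = 1 := by
  obtain ⟨b, hb⟩ := exists_isFrame hp ha hpa
  exact (hb.greatCircle s).norm_x

/-- If the second derivative were positive, the point would also be a local minimum. Then `φ` would
be locally constant and its second derivative zero. -/
lemma IsLocalMax.second_order {φ φ' : ℝ → ℝ} {φ'' : ℝ} (h : ∀ s, HasDerivAt φ (φ' s) s)
    (h' : HasDerivAt φ' φ'' 0) (hmax : IsLocalMax φ 0) : φ' 0 = 0 ∧ φ'' ≤ 0 := by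
  have h0 : φ' 0 = 0 := hmax.hasDerivAt_eq_zero (h 0)
  refine ⟨h0, ?_⟩
  by_contra! hpos
  have hd : deriv φ = φ' := funext fun s => (h s).deriv
  have hmin : IsLocalMin φ 0 := isLocalMin_of_deriv_deriv_pos
    (by rw [hd, h'.deriv]; exact hpos) (by rw [hd, h0]) (h 0).continuousAt
  have hconst : φ =ᶠ[𝓝 0] fun _ => φ 0 := by
    filter_upwards [hmax, hmin] with s h1 h2 using le_antisymm h1 h2
  have hd0 : φ' =ᶠ[𝓝 0] fun _ => 0 := by
    filter_upwards [hconst.eventuallyEq_nhds] with s hs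
    exact (h s).unique ((hasDerivAt_const s (φ 0)).congr_of_eventuallyEq hs)
  have := h'.unique ((hasDerivAt_const (0 : ℝ) (0 : ℝ)).congr_of_eventuallyEq hd0)
  exact hpos.ne' this

/-! ### Gradients of support functions. -/

/-- `X` is the gradient of a positively homogeneous function of degree one, of class `C³` away
from the origin. -/
structure IsSupportGradient (X : Space3 → Space3) : Prop where
  contDiffOn : ContDiffOn ℝ 2 X {0}ᶜ
  smul : ∀ c : ℝ, 0 < c → ∀ x, x ≠ 0 → X (c • x) = X x
  symm : ∀ x, x ≠ 0 → ∀ a b, inner ℝ (fderiv ℝ X x a) b = (inner ℝ a (fderiv ℝ X x b) : ℝ)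

/-- The derivative of `X` is positive definite on the tangent planes of the unit sphere. -/
def IsTangentiallyPositive (X : Space3 → Space3) : Prop :=
  ∀ x a : Space3, ‖x‖ = 1 → inner ℝ x a = (0 : ℝ) → a ≠ 0 → 0 < (inner ℝ (fderiv ℝ X x a) a : ℝ)

lemma ne_zero_of_norm_eq_one {x : Space3} (h : ‖x‖ = 1) : x ≠ 0 := by
  rintro rfl; simp at h

lemma eventually_ne_zero {x : Space3} (h : x ≠ 0) : ∀ᶠ y in 𝓝 x, y ≠ 0 :=
  isOpen_compl_singleton.mem_nhds h

/-- Euler's relation for homogeneous maps of degree zero. -/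
lemma HasFDerivAt.apply_self_of_homogeneous {X : Space3 → Space3} {X' : Space3 →L[ℝ] Space3}
    {x : Space3} (h : HasFDerivAt X X' x) (hs : ∀ c : ℝ, 0 < c → X (c • x) = X x) :
    X' x = 0 := by
  have h1 : HasDerivAt (fun c : ℝ => X (c • x)) (X' x) 1 := by
    have hl : HasDerivAt (fun c : ℝ => c • x) x 1 := by
      simpa using (hasDerivAt_id (1 : ℝ)).smul_const x
    rw [← one_smul ℝ x] at h
    have h2 := h.comp_hasDerivAt (1 : ℝ) hl
    exact h2
  have h2 : (fun c : ℝ => X (c • x)) =ᶠ[𝓝 1] fun _ => X x := by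
    filter_upwards [lt_mem_nhds one_pos] with c hc using hs c hc
  exact h1.unique ((hasDerivAt_const (1 : ℝ) (X x)).congr_of_eventuallyEq h2)

/-- The derivative of a homogeneous map of degree zero is homogeneous of degree minus one. -/
lemma fderiv_eq_smul_of_homogeneous {X : Space3 → Space3} {x : Space3} (hx : x ≠ 0) {c : ℝ}
    (hs : ∀ y, y ≠ 0 → X (c • y) = X y) (hd : DifferentiableAt ℝ X x)
    (hdc : DifferentiableAt ℝ X (c • x)) : fderiv ℝ X x = c • fderiv ℝ X (c • x) := by
  have h1 := hdc.hasFDerivAt.comp x ((hasFDerivAt_id x).const_smul c)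
  have h2 : (X ∘ fun y => c • id y) =ᶠ[𝓝 x] X := by
    filter_upwards [eventually_ne_zero hx] with y hy using hs y hy
  have h3 := h1.unique (hd.hasFDerivAt.congr_of_eventuallyEq h2)
  rw [← h3]
  ext v : 1
  simp

namespace IsSupportGradient

variable {X X₁ X₂ : Space3 → Space3}

lemma contDiffAt (h : IsSupportGradient X) {x : Space3} (hx : x ≠ 0) : ContDiffAt ℝ 2 X x :=
  h.contDiffOn.contDiffAt (isOpen_compl_singleton.mem_nhds hx)

lemma hasFDerivAt (h : IsSupportGradient X) {x : Space3} (hx : x ≠ 0) :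
    HasFDerivAt X (fderiv ℝ X x) x :=
  ((h.contDiffAt hx).differentiableAt (by norm_num)).hasFDerivAt

lemma contDiffOn_fderiv (h : IsSupportGradient X) : ContDiffOn ℝ 1 (fderiv ℝ X) {0}ᶜ :=
  h.contDiffOn.fderiv_of_isOpen isOpen_compl_singleton (by norm_num)

lemma hasFDerivAt_fderiv (h : IsSupportGradient X) {x : Space3} (hx : x ≠ 0) :
    HasFDerivAt (fderiv ℝ X) (fderiv ℝ (fderiv ℝ X) x) x :=
  ((h.contDiffOn_fderiv.contDiffAt (isOpen_compl_singleton.mem_nhds hx)).differentiableAt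
    (by norm_num)).hasFDerivAt

lemma continuousOn_fderiv_fderiv (h : IsSupportGradient X) :
    ContinuousOn (fderiv ℝ (fderiv ℝ X)) {0}ᶜ :=
  (h.contDiffOn_fderiv.fderiv_of_isOpen (m := 0) isOpen_compl_singleton
    (by norm_num)).continuousOn

lemma fderiv_sub (h₁ : IsSupportGradient X₁) (h₂ : IsSupportGradient X₂) {x : Space3}
    (hx : x ≠ 0) : fderiv ℝ (X₁ - X₂) x = fderiv ℝ X₁ x - fderiv ℝ X₂ x :=
  ((h₁.hasFDerivAt hx).sub (h₂.hasFDerivAt hx)).fderiv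

lemma fderiv_fderiv_sub (h₁ : IsSupportGradient X₁) (h₂ : IsSupportGradient X₂) {x : Space3}
    (hx : x ≠ 0) : fderiv ℝ (fderiv ℝ (X₁ - X₂)) x =
      fderiv ℝ (fderiv ℝ X₁) x - fderiv ℝ (fderiv ℝ X₂) x := by
  have h : fderiv ℝ (X₁ - X₂) =ᶠ[𝓝 x] fderiv ℝ X₁ - fderiv ℝ X₂ := by
    filter_upwards [eventually_ne_zero hx] with y hy using fderiv_sub h₁ h₂ hy
  rw [h.fderiv_eq]
  exact ((h₁.hasFDerivAt_fderiv hx).sub (h₂.hasFDerivAt_fderiv hx)).fderiv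

lemma sub (h₁ : IsSupportGradient X₁) (h₂ : IsSupportGradient X₂) :
    IsSupportGradient (X₁ - X₂) where
  contDiffOn := h₁.contDiffOn.sub h₂.contDiffOn
  smul c hc x hx := by simp [h₁.smul c hc x hx, h₂.smul c hc x hx]
  symm x hx a b := by
    rw [fderiv_sub h₁ h₂ hx]
    simp [inner_sub_left, inner_sub_right, h₁.symm x hx, h₂.symm x hx]

lemma fderiv_self (h : IsSupportGradient X) {x : Space3} (hx : x ≠ 0) : fderiv ℝ X x x = 0 :=
  (h.hasFDerivAt hx).apply_self_of_homogeneous fun c hc => h.smul c hc x hx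

/-- Differentiate Euler's relation `fderiv ℝ X y y = 0` in the direction `a`. -/
lemma fderiv_fderiv_apply_self (h : IsSupportGradient X) {x : Space3} (hx : x ≠ 0)
    (a : Space3) : fderiv ℝ (fderiv ℝ X) x a x = -fderiv ℝ X x a := by
  have h1 : HasFDerivAt (fun y => fderiv ℝ X y y) _ x :=
    (h.hasFDerivAt_fderiv hx).clm_apply (hasFDerivAt_id x)
  have h2 : (fun y => fderiv ℝ X y y) =ᶠ[𝓝 x] fun _ => 0 := by
    filter_upwards [eventually_ne_zero hx] with y hy using h.fderiv_self hy
  have h3 := h1.unique ((hasFDerivAt_const (0 : Space3) x).congr_of_eventuallyEq h2)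
  have h4 := DFunLike.congr_fun h3 a
  simp at h4
  exact eq_neg_of_add_eq_zero_right h4

lemma inner_fderiv_fderiv (h : IsSupportGradient X) {x : Space3} (hx : x ≠ 0) (a b c : Space3) :
    inner ℝ (fderiv ℝ (fderiv ℝ X) x a b) c = (inner ℝ b (fderiv ℝ (fderiv ℝ X) x a c) : ℝ) := by
  have hd : ∀ v : Space3, HasFDerivAt (fun y => fderiv ℝ X y v)
      ((fderiv ℝ (fderiv ℝ X) x).flip v) x := fun v => by
    have := (h.hasFDerivAt_fderiv hx).clm_apply (hasFDerivAt_const v x)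
    refine this.congr_fderiv ?_
    ext; simp
  have h1 := (hd b).inner ℝ (hasFDerivAt_const c x)
  have h2 := (hasFDerivAt_const b x).inner ℝ (hd c)
  have h3 : (fun y => inner ℝ (fderiv ℝ X y b) c) =ᶠ[𝓝 x]
      fun y => (inner ℝ b (fderiv ℝ X y c) : ℝ) := by
    filter_upwards [eventually_ne_zero hx] with y hy using h.symm y hy b c
  have h4 := DFunLike.congr_fun (h1.unique (h2.congr_of_eventuallyEq h3)) a
  simpa using h4

lemma fderiv_fderiv_comm (h : IsSupportGradient X) {x : Space3} (hx : x ≠ 0) (a b : Space3) :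
    fderiv ℝ (fderiv ℝ X) x a b = fderiv ℝ (fderiv ℝ X) x b a :=
  (h.contDiffAt hx).isSymmSndFDerivAt (by simp) a b

lemma inner_fderiv_comb (h : IsSupportGradient X) {x : Space3} (hx : x ≠ 0) (a b : Space3)
    (s t : ℝ) : (inner ℝ (fderiv ℝ X x (s • a + t • b)) (s • a + t • b) : ℝ) =
      inner ℝ (fderiv ℝ X x a) a * s ^ 2 + 2 * inner ℝ (fderiv ℝ X x a) b * (s * t) +
        inner ℝ (fderiv ℝ X x b) b * t ^ 2 := by
  have hsym : (inner ℝ (fderiv ℝ X x b) a : ℝ) = inner ℝ (fderiv ℝ X x a) b := by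
    rw [h.symm x hx, real_inner_comm]
  simp only [map_add, map_smul, inner_add_left, inner_add_right, real_inner_smul_left,
    real_inner_smul_right, hsym]
  ring

lemma exists_norm_fderiv_fderiv_le (h : IsSupportGradient X) :
    ∃ C : ℝ, 0 < C ∧ ∀ x : Space3, ‖x‖ = 1 → ‖fderiv ℝ (fderiv ℝ X) x‖ ≤ C := by
  have hs : Metric.sphere (0 : Space3) 1 ⊆ {0}ᶜ := fun x hx =>
    ne_zero_of_norm_eq_one (by simpa using hx)
  have hc : ContinuousOn (fun x => ‖fderiv ℝ (fderiv ℝ X) x‖) (Metric.sphere (0 : Space3) 1) :=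
    (continuous_norm (E := Space3 →L[ℝ] Space3 →L[ℝ] Space3)).comp_continuousOn
      (h.continuousOn_fderiv_fderiv.mono hs)
  obtain ⟨C, hC⟩ := (isCompact_sphere (0 : Space3) 1).bddAbove_image hc
  exact ⟨max C 1, by positivity, fun x hx =>
    (hC ⟨x, by simpa using hx, rfl⟩).trans (le_max_left _ _)⟩

/-- The unit tangent bundle `S` of the sphere is compact, so the quadratic form of the derivative
has a positive minimum `r` and a maximum `R` on it. -/
lemma exists_radiiBox (h : IsSupportGradient X) (hpos : IsTangentiallyPositive X) :
    ∃ r R : ℝ, 0 < r ∧ ∀ x a b, IsFrame x a b →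
      ((planarForm (fderiv ℝ X x) a b).1, ‖(planarForm (fderiv ℝ X x) a b).2‖) ∈
        radiiBox r R := by
  let S : Set (Space3 × Space3) := {y | ‖y.1‖ = 1 ∧ ‖y.2‖ = 1 ∧ inner ℝ y.1 y.2 = (0 : ℝ)}
  have hScl : IsClosed S := by
    have e1 : IsClosed {y : Space3 × Space3 | ‖y.1‖ = 1} := isClosed_eq (by fun_prop) (by fun_prop)
    have e2 : IsClosed {y : Space3 × Space3 | ‖y.2‖ = 1} := isClosed_eq (by fun_prop) (by fun_prop)
    have e3 : IsClosed {y : Space3 × Space3 | inner ℝ y.1 y.2 = (0 : ℝ)} :=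
      isClosed_eq (by fun_prop) (by fun_prop)
    exact e1.inter (e2.inter e3)
  have hS : IsCompact S :=
    ((isCompact_sphere (0 : Space3) 1).prod (isCompact_sphere (0 : Space3) 1)).of_isClosed_subset
      hScl fun y hy => by simpa using ⟨hy.1, hy.2.1⟩
  have hcont : ContinuousOn (fun y : Space3 × Space3 => (inner ℝ (fderiv ℝ X y.1 y.2) y.2 : ℝ))
      S := by
    have h1 : ContinuousOn (fun y : Space3 × Space3 => fderiv ℝ X y.1) S :=
      h.contDiffOn_fderiv.continuousOn.comp continuousOn_fst
        fun y hy => ne_zero_of_norm_eq_one hy.1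
    exact (h1.clm_apply continuousOn_snd).inner continuousOn_snd
  rcases S.eq_empty_or_nonempty with he | hne
  · refine ⟨1, 1, one_pos, fun x a b hf => ?_⟩
    have : (x, a) ∈ S := ⟨hf.norm_x, hf.norm_a, hf.inner_xa⟩
    simp [he] at this
  obtain ⟨y, hy, hmin⟩ := hS.exists_isMinOn hne hcont
  obtain ⟨y', hy', hmax⟩ := hS.exists_isMaxOn hne hcont
  refine ⟨_, inner ℝ (fderiv ℝ X y'.1 y'.2) y'.2,
    hpos y.1 y.2 hy.1 hy.2.2 (ne_zero_of_norm_eq_one hy.2.1), fun x a b hf => ?_⟩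
  set r : ℝ := inner ℝ (fderiv ℝ X y.1 y.2) y.2 with hr
  set R : ℝ := inner ℝ (fderiv ℝ X y'.1 y'.2) y'.2 with hR
  have hx0 := ne_zero_of_norm_eq_one hf.norm_x
  have key : ∀ s t : ℝ, s ^ 2 + t ^ 2 = 1 →
      r ≤ inner ℝ (fderiv ℝ X x a) a * s ^ 2 + 2 * inner ℝ (fderiv ℝ X x a) b * (s * t) +
        inner ℝ (fderiv ℝ X x b) b * t ^ 2 ∧
      inner ℝ (fderiv ℝ X x a) a * s ^ 2 + 2 * inner ℝ (fderiv ℝ X x a) b * (s * t) +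
        inner ℝ (fderiv ℝ X x b) b * t ^ 2 ≤ R := fun s t hst => by
    have hmem : (x, s • a + t • b) ∈ S := ⟨hf.norm_x, hf.norm_comb hst, hf.inner_comb s t⟩
    rw [← h.inner_fderiv_comb hx0]
    exact ⟨hmin hmem, hmax hmem⟩
  -- Subtracting `r` times the identity from the form, and the form from `R` times the identity,
  -- leaves semidefinite forms with the same trace-free part up to sign.
  have h1 := norm_formPart_snd_le (p := inner ℝ (fderiv ℝ X x a) a - r)
    (q := inner ℝ (fderiv ℝ X x a) b) (r := inner ℝ (fderiv ℝ X x b) b - r) fun s t hst => by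
      have := (key s t hst).1
      have e : r * s ^ 2 + r * t ^ 2 = r := by rw [← mul_add, hst, mul_one]
      linarith
  have h2 := norm_formPart_snd_le (p := R - inner ℝ (fderiv ℝ X x a) a)
    (q := -inner ℝ (fderiv ℝ X x a) b) (r := R - inner ℝ (fderiv ℝ X x b) b) fun s t hst => by
      have := (key s t hst).2
      have e : R * s ^ 2 + R * t ^ 2 = R := by rw [← mul_add, hst, mul_one]
      linarith
  have e1 : (formPart (inner ℝ (fderiv ℝ X x a) a - r) (inner ℝ (fderiv ℝ X x a) b)
      (inner ℝ (fderiv ℝ X x b) b - r)).2 = (planarForm (fderiv ℝ X x) a b).2 := by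
    apply Complex.ext <;> simp [formPart, planarForm]
  have e2 : (formPart (R - inner ℝ (fderiv ℝ X x a) a) (-inner ℝ (fderiv ℝ X x a) b)
      (R - inner ℝ (fderiv ℝ X x b) b)).2 = -(planarForm (fderiv ℝ X x) a b).2 := by
    apply Complex.ext <;> simp [formPart, planarForm]
    ring
  rw [e1] at h1
  rw [e2, norm_neg] at h2
  refine ⟨?_, ?_⟩ <;> simp only [abs_norm] <;> simp only [formPart, planarForm] at h1 h2 ⊢ <;>
    linarith

/-- Necessary conditions at a maximum on the unit sphere of a component of `X` perturbed by an
exponential barrier. -/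
lemma barrier_conditions (h : IsSupportGradient X) {p a e : Space3} (hp : ‖p‖ = 1) (ha : ‖a‖ = 1)
    (hpa : inner ℝ p a = (0 : ℝ)) {ε l : ℝ}
    (hmax : ∀ x : Space3, ‖x‖ = 1 → (inner ℝ (X x) e : ℝ) + ε * Real.exp (l * inner ℝ x e) ≤
      (inner ℝ (X p) e : ℝ) + ε * Real.exp (l * inner ℝ p e)) :
    (inner ℝ (fderiv ℝ X p a) e : ℝ) + ε * (Real.exp (l * inner ℝ p e) * (l * inner ℝ a e)) = 0 ∧
    (inner ℝ (fderiv ℝ (fderiv ℝ X) p a a) e : ℝ) +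
      ε * Real.exp (l * inner ℝ p e) * (l ^ 2 * (inner ℝ a e) ^ 2 - l * inner ℝ p e) ≤ 0 := by
  have hc0 : ∀ s, greatCircle p a s ≠ 0 := fun s =>
    ne_zero_of_norm_eq_one (norm_greatCircle hp ha hpa s)
  have hd : ∀ s, HasDerivAt (fun s => (inner ℝ (X (greatCircle p a s)) e : ℝ) +
      ε * Real.exp (l * inner ℝ (greatCircle p a s) e))
      (inner ℝ (fderiv ℝ X (greatCircle p a s) (greatCircle a (-p) s)) e +
        ε * (Real.exp (l * inner ℝ (greatCircle p a s) e) *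
          (l * inner ℝ (greatCircle a (-p) s) e))) s := fun s => by
    have h1 := ((h.hasFDerivAt (hc0 s)).comp_hasDerivAt s (hasDerivAt_greatCircle p a s)).inner ℝ
      (hasDerivAt_const s e)
    have h2 := (hasDerivAt_greatCircle p a s).inner ℝ (hasDerivAt_const s e)
    have h3 := h1.add (((h2.const_mul l).exp).const_mul ε)
    refine h3.congr_deriv ?_
    simp
  have hd' : HasDerivAt (fun s => (inner ℝ (fderiv ℝ X (greatCircle p a s)
      (greatCircle a (-p) s)) e : ℝ) + ε * (Real.exp (l * inner ℝ (greatCircle p a s) e) *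
          (l * inner ℝ (greatCircle a (-p) s) e)))
      (inner ℝ (fderiv ℝ (fderiv ℝ X) p a a) e +
        ε * Real.exp (l * inner ℝ p e) * (l ^ 2 * (inner ℝ a e) ^ 2 - l * inner ℝ p e)) 0 := by
    have h1 := (h.hasFDerivAt_fderiv (hc0 0)).comp_hasDerivAt (0 : ℝ)
      (hasDerivAt_greatCircle p a 0)
    have h2 := (h1.clm_apply (hasDerivAt_greatCircle a (-p) 0)).inner ℝ
      (hasDerivAt_const (0 : ℝ) e)
    have h3 := (hasDerivAt_greatCircle p a 0).inner ℝ (hasDerivAt_const (0 : ℝ) e)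
    have h4 := (hasDerivAt_greatCircle a (-p) 0).inner ℝ (hasDerivAt_const (0 : ℝ) e)
    have h5 := h2.add ((((h3.const_mul l).exp).mul (h4.const_mul l)).const_mul ε)
    refine h5.congr_deriv ?_
    -- The acceleration of the great circle is `-p`. It drops out of the `X` term because the
    -- derivative of `X` kills `p`, but leaves `-l ⟪p, e⟫` in the exponential term.
    simp only [Function.comp, greatCircle_zero, inner_zero_right, zero_add, inner_add_left,
      inner_neg_left, map_neg, h.fderiv_self (ne_zero_of_norm_eq_one hp), neg_zero, inner_zero_left]
    ring
  have hm : IsLocalMax (fun s => (inner ℝ (X (greatCircle p a s)) e : ℝ) +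
      ε * Real.exp (l * inner ℝ (greatCircle p a s) e)) 0 :=
    Filter.Eventually.of_forall fun s => by
      simpa only [greatCircle_zero] using hmax _ (norm_greatCircle hp ha hpa s)
  have := hm.second_order hd hd'
  simpa only [greatCircle_zero] using this

end IsSupportGradient

/-! ### The barrier estimate and the maximum principle for components. -/

/-- The curvature condition: equal values of the curvature function in every tangent frame. -/
def HaveEqualCurvature (G : ℝ × ℝ → ℝ) (X₁ X₂ : Space3 → Space3) : Prop :=
  ∀ x a b, IsFrame x a b →
    G ((planarForm (fderiv ℝ X₁ x) a b).1, ‖(planarForm (fderiv ℝ X₁ x) a b).2‖) =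
      G ((planarForm (fderiv ℝ X₂ x) a b).1, ‖(planarForm (fderiv ℝ X₂ x) a b).2‖)

/-- The rotation of the frame contributes nothing: the moving vector has derivative `-p`, while the
derivative of `X` at `p` kills `p` and has image orthogonal to `p`. -/
lemma IsSupportGradient.hasDerivAt_planarForm {X : Space3 → Space3} (h : IsSupportGradient X)
    {p a b : Space3} (hf : IsFrame p a b) :
    HasDerivAt (fun s => planarForm (fderiv ℝ X (greatCircle p a s)) (greatCircle a (-p) s) b)
      (planarForm (fderiv ℝ (fderiv ℝ X) p a) a b) 0 := by
  have hp := ne_zero_of_norm_eq_one hf.norm_x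
  have h0 : greatCircle p a 0 ≠ 0 := by rwa [greatCircle_zero]
  have h1 := (h.hasFDerivAt_fderiv h0).comp_hasDerivAt (0 : ℝ) (hasDerivAt_greatCircle p a 0)
  have h2 := hasDerivAt_greatCircle a (-p) 0
  have h3 := h1.clm_apply h2
  have h4 := h1.clm_apply (hasDerivAt_const (0 : ℝ) b)
  have hpa : ∀ v, (inner ℝ (fderiv ℝ X p v) p : ℝ) = 0 := fun v => by
    rw [h.symm p hp, h.fderiv_self hp, inner_zero_right]
  have h5 := ((h3.inner ℝ h2).formPart (h3.inner ℝ (hasDerivAt_const (0 : ℝ) b))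
    (h4.inner ℝ (hasDerivAt_const (0 : ℝ) b)))
  refine h5.congr_deriv ?_
  simp [planarForm, greatCircle_zero, h.fderiv_self hp, hpa]

lemma IsEllipticRadial.abs_radialFDeriv_le {G : ℝ × ℝ → ℝ} {w : ℝ × ℂ} {C : ℝ}
    (h1 : ‖axialGrad G w‖ ≤ fderiv ℝ G (w.1, ‖w.2‖) (1, 0))
    (h2 : fderiv ℝ G (w.1, ‖w.2‖) (1, 0) ≤ C) (d : ℝ × ℂ) :
    |radialFDeriv G w d| ≤ 2 * C * ‖d‖ := by
  rw [radialFDeriv_apply]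
  have h3 := abs_real_inner_le_norm (axialGrad G w) d.2
  have h4 : |d.1| ≤ ‖d‖ := norm_fst_le d
  have h5 : ‖d.2‖ ≤ ‖d‖ := norm_snd_le d
  have h0 := (norm_nonneg _).trans h1
  calc _ ≤ |fderiv ℝ G (w.1, ‖w.2‖) (1, 0)| * |d.1| + ‖axialGrad G w‖ * ‖d.2‖ := by
        refine (abs_add_le _ _).trans ?_
        rw [abs_mul]
        gcongr
    _ ≤ C * ‖d‖ + C * ‖d‖ := by
        rw [abs_of_nonneg h0]
        have := h1.trans h2
        have := h0.trans h2
        gcongr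
    _ = _ := by ring

lemma radialFDeriv_nonpos {G : ℝ × ℝ → ℝ} {w d : ℝ × ℂ}
    (h1 : ‖axialGrad G w‖ ≤ fderiv ℝ G (w.1, ‖w.2‖) (1, 0)) (hd : ‖d.2‖ ≤ -d.1) :
    radialFDeriv G w d ≤ 0 := by
  rw [radialFDeriv_apply]
  have h3 := (abs_le.1 (abs_real_inner_le_norm (axialGrad G w) d.2)).2
  have h4 := mul_le_mul_of_nonneg_left hd (norm_nonneg (axialGrad G w))
  have h5 := mul_le_mul_of_nonneg_right h1 ((norm_nonneg _).trans hd)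
  linarith

lemma IsEllipticRadial.hasDerivAt_curvature {G : ℝ × ℝ → ℝ} (hG : IsEllipticRadial G)
    {X : Space3 → Space3} (h : IsSupportGradient X) {p a b : Space3} (hf : IsFrame p a b)
    (hm : ‖(planarForm (fderiv ℝ X p) a b).2‖ < (planarForm (fderiv ℝ X p) a b).1) :
    HasDerivAt (fun s => G ((planarForm (fderiv ℝ X (greatCircle p a s))
        (greatCircle a (-p) s) b).1, ‖(planarForm (fderiv ℝ X (greatCircle p a s))
        (greatCircle a (-p) s) b).2‖))
      (radialFDeriv G (planarForm (fderiv ℝ X p) a b)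
        (planarForm (fderiv ℝ (fderiv ℝ X) p a) a b)) 0 := by
  have h6 := hG.hasFDerivAt_radial hm
  have h7 : planarForm (fderiv ℝ X p) a b = (fun s => planarForm
      (fderiv ℝ X (greatCircle p a s)) (greatCircle a (-p) s) b) 0 := by
    simp only [greatCircle_zero]
  rw [h7] at h6 ⊢
  exact h6.comp_hasDerivAt (0 : ℝ) (h.hasDerivAt_planarForm hf)

set_option maxHeartbeats 1600000 in
/-- At a point where `⟪X₁ - X₂, e⟫ + ε exp (l ⟪·, e⟫)` is maximal on the sphere, `l` cannot be
large. -/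
lemma exists_barrier_bound {G : ℝ × ℝ → ℝ} (hG : IsEllipticRadial G) {X₁ X₂ : Space3 → Space3}
    (h₁ : IsSupportGradient X₁) (h₂ : IsSupportGradient X₂) (hpos₁ : IsTangentiallyPositive X₁)
    (hpos₂ : IsTangentiallyPositive X₂) (heq : HaveEqualCurvature G X₁ X₂) :
    ∃ C : ℝ, 0 < C ∧ ∀ (p e : Space3) (ε l : ℝ), ‖p‖ = 1 → ‖e‖ = 1 → 0 < ε → 0 < l →
      (∀ x : Space3, ‖x‖ = 1 →
        (inner ℝ ((X₁ - X₂) x) e : ℝ) + ε * Real.exp (l * inner ℝ x e) ≤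
          (inner ℝ ((X₁ - X₂) p) e : ℝ) + ε * Real.exp (l * inner ℝ p e)) →
      l * (1 - (inner ℝ p e) ^ 2) ≤ C := by
  obtain ⟨r₁, R₁, hr₁, hbox₁⟩ := h₁.exists_radiiBox hpos₁
  obtain ⟨r₂, R₂, hr₂, hbox₂⟩ := h₂.exists_radiiBox hpos₂
  obtain ⟨D, hD, hDle⟩ := h₂.exists_norm_fderiv_fderiv_le
  set r := min r₁ r₂
  set R := max R₁ R₂
  have hr : 0 < r := lt_min hr₁ hr₂
  have hmono₁ : radiiBox r₁ R₁ ⊆ radiiBox r R := fun q hq =>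
    ⟨(min_le_left _ _).trans hq.1, hq.2.trans (le_max_left _ _)⟩
  have hmono₂ : radiiBox r₂ R₂ ⊆ radiiBox r R := fun q hq =>
    ⟨(min_le_right _ _).trans hq.1, hq.2.trans (le_max_right _ _)⟩
  obtain ⟨c, C, hc, hC, hcC⟩ := hG.exists_bounds (r := r) (R := R) hr
  obtain ⟨K, hK, hKle⟩ := hG.exists_lipschitz (r := r) (R := R) hr
  set M := 1 + 2 * C / c with hM
  have hM1 : 0 < M := by positivity
  -- `M E` will bound `w₁ - w₂`. The three summands come from the differentiated equation, from the
  -- term `z • (w₁ - w₂)` and from the term `z • formPart 1 0 1`; the factor `2 / c` inverts the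
  -- lower bound `hτ`.
  refine ⟨2 / c * (K * M * (2 * D) + 2 * C * M + C), by positivity, ?_⟩
  intro p e ε l hp he hε hl hmax
  have hX := h₁.sub h₂
  have hp0 := ne_zero_of_norm_eq_one hp
  set z : ℝ := inner ℝ p e with hz
  have hz1 : |z| ≤ 1 := by simpa [hp, he] using abs_real_inner_le_norm p e
  have hz2 : z ^ 2 ≤ 1 := by rw [← sq_abs]; nlinarith [abs_nonneg z]
  rcases hz2.eq_or_lt with h1 | hzlt
  · rw [h1, sub_self, mul_zero]; positivity
  set σ := √(1 - z ^ 2) with hσ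
  have hσ2 : σ ^ 2 = 1 - z ^ 2 := Real.sq_sqrt (by linarith)
  have hσ0 : 0 < σ := Real.sqrt_pos.2 (by linarith)
  have hσ1 : σ ≤ 1 := by nlinarith [sq_nonneg z]
  have hpp : inner ℝ p p = (1 : ℝ) := by rw [real_inner_self_eq_norm_sq, hp, one_pow]
  have hee : inner ℝ e e = (1 : ℝ) := by rw [real_inner_self_eq_norm_sq, he, one_pow]
  have hep : inner ℝ e p = z := by rw [real_inner_comm]
  -- The unit tangent vector at `p` pointing towards `e`.
  set a : Space3 := σ⁻¹ • (e - z • p) with ha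
  have hea : e = z • p + σ • a := by
    rw [ha, smul_smul, mul_inv_cancel₀ hσ0.ne', one_smul]; abel
  have hpa : inner ℝ p a = (0 : ℝ) := by
    rw [ha, real_inner_smul_right, inner_sub_right, real_inner_smul_right, hpp, ← hz]; ring
  have haa : inner ℝ a a = (1 : ℝ) := by
    rw [ha, real_inner_smul_right, real_inner_smul_left, inner_sub_right, inner_sub_left,
      inner_sub_left, real_inner_smul_right, real_inner_smul_right, real_inner_smul_left,
      real_inner_smul_left, hpp, hee, hep, ← hz]
    field_simp
    linarith
  have hna : ‖a‖ = 1 := by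
    rw [real_inner_self_eq_norm_sq] at haa
    exact (pow_eq_one_iff_of_nonneg (norm_nonneg _) two_ne_zero).1 haa
  obtain ⟨b, hf⟩ := exists_isFrame hp hna hpa
  have hap : inner ℝ a p = (0 : ℝ) := by rw [real_inner_comm]; exact hpa
  have hbp : inner ℝ b p = (0 : ℝ) := by rw [real_inner_comm]; exact hf.inner_xb
  have hba : inner ℝ b a = (0 : ℝ) := by rw [real_inner_comm]; exact hf.inner_ab
  set Y := fderiv ℝ (X₁ - X₂) p with hY
  set Y' := fderiv ℝ (fderiv ℝ (X₁ - X₂)) p with hY'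
  set E := ε * l * Real.exp (l * z) with hE
  have hE0 : 0 < E := by positivity
  have hYp : ∀ v, (inner ℝ (Y v) p : ℝ) = 0 := fun v => by
    rw [hY, hX.symm p hp0, hX.fderiv_self hp0, inner_zero_right]
  have hYe : ∀ v, (inner ℝ (Y v) e : ℝ) = σ * inner ℝ (Y v) a := fun v => by
    conv_lhs => rw [hea]
    rw [inner_add_right, real_inner_smul_right, real_inner_smul_right, hYp]; ring
  have hae : inner ℝ a e = σ := by
    conv_lhs => rw [hea]
    rw [inner_add_right, real_inner_smul_right, real_inner_smul_right, hap, haa]; ring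
  have hbe : inner ℝ b e = (0 : ℝ) := by
    conv_lhs => rw [hea]
    rw [inner_add_right, real_inner_smul_right, real_inner_smul_right, hbp, hba]; ring
  -- The first order conditions in the directions `a` and `b` determine the whole row of `Y`
  -- belonging to `a`: it is `(-E, 0)`.
  have hYaa : (inner ℝ (Y a) a : ℝ) = -E := by
    have := (hX.barrier_conditions hp hna hpa hmax).1
    rw [← hY, hYe, hae] at this
    have h2 : σ * ((inner ℝ (Y a) a : ℝ) + E) = 0 := by rw [hE]; linarith
    rcases mul_eq_zero.1 h2 with h3 | h3
    · exact absurd h3 hσ0.ne'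
    · linarith
  have hYab : (inner ℝ (Y a) b : ℝ) = 0 := by
    have := (hX.barrier_conditions hp hf.norm_b hf.inner_xb hmax).1
    rw [← hY, hYe, hbe, mul_zero, mul_zero, mul_zero, add_zero] at this
    rcases mul_eq_zero.1 this with h3 | h3
    · exact absurd h3 hσ0.ne'
    · rw [hY, hX.symm p hp0, ← hY, real_inner_comm]; exact h3
  set w : ℝ := inner ℝ (Y b) b with hw
  have hω : planarForm Y a b = formPart (-E) 0 w := by
    rw [planarForm, hYaa, hYab, ← hw]
  set w₁ := planarForm (fderiv ℝ X₁ p) a b with hw₁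
  set w₂ := planarForm (fderiv ℝ X₂ p) a b with hw₂
  have hm₁ : (w₁.1, ‖w₁.2‖) ∈ radiiBox r R := hmono₁ (hbox₁ p a b hf)
  have hm₂ : (w₂.1, ‖w₂.2‖) ∈ radiiBox r R := hmono₂ (hbox₂ p a b hf)
  have hdiff : w₁ - w₂ = formPart (-E) 0 w := by
    rw [← hω, hY, h₁.fderiv_sub h₂ hp0, planarForm_sub]
  -- the remaining diagonal entry is comparable to `E`
  have hwE : 0 ≤ w ∧ w ≤ 2 * C / c * E := by
    obtain ⟨x, hx, hx0⟩ := hG.exists_radialFDeriv_eq_zero hr hm₁ hm₂ (heq p a b hf)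
    obtain ⟨hx1, hx2⟩ := hcC x hx
    rw [hdiff, radialFDeriv_apply] at hx0
    set A := fderiv ℝ G (x.1, ‖x.2‖) (1, 0)
    set N := axialGrad G x
    have hN := abs_le.1 (Complex.abs_re_le_norm N)
    have h3 : w * (A - N.re) = E * (A + N.re) := by
      simp only [formPart, Complex.inner, Complex.mul_re, Complex.conj_re, Complex.conj_im] at hx0
      linarith
    have h4 : c ≤ A - N.re := by linarith [hN.2]
    have h5 : 0 ≤ A + N.re := by linarith [hN.1]
    have h6 : A + N.re ≤ 2 * C := by linarith [hN.2]
    have h7 : 0 ≤ w := by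
      by_contra! hneg
      have := mul_nonneg hE0.le h5
      nlinarith
    refine ⟨h7, ?_⟩
    rw [div_mul_eq_mul_div, le_div_iff₀ hc]
    nlinarith [mul_le_mul_of_nonneg_left h4 h7, mul_le_mul_of_nonneg_left h6 hE0.le]
  have hnω : ‖w₁ - w₂‖ ≤ M * E := by
    have e1 : M * E = E + 2 * C / c * E := by rw [hM]; ring
    rw [hdiff, e1]
    refine max_le ?_ ((Complex.norm_le_abs_re_add_abs_im _).trans ?_)
    · simp only [formPart]
      rw [Real.norm_eq_abs, abs_le]; constructor <;> linarith [hwE.1, hwE.2]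
    · simp only [formPart, abs_zero, add_zero]
      rw [abs_le]; constructor <;> linarith [hwE.1, hwE.2]
  -- differentiate the equation along the great circle towards `e`
  set β := planarForm (Y' a) a b with hβ
  set β₂ := planarForm (fderiv ℝ (fderiv ℝ X₂) p a) a b with hβ₂
  have hlt : ∀ {v : ℝ × ℂ}, (v.1, ‖v.2‖) ∈ radiiBox r R → ‖v.2‖ < v.1 := fun hv => by
    simpa using radiiBox_subset hr hv
  have hlβ : |radialFDeriv G w₁ β| ≤ K * M * (2 * D) * E := by
    have e1 := (hG.hasDerivAt_curvature h₁ hf (hlt hm₁)).unique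
      ((hG.hasDerivAt_curvature h₂ hf (hlt hm₂)).congr_of_eventuallyEq
      (Filter.Eventually.of_forall fun s => heq _ _ _ (hf.greatCircle s)))
    have e2 : β = planarForm (fderiv ℝ (fderiv ℝ X₁) p a) a b - β₂ := by
      rw [hβ, hY', h₁.fderiv_fderiv_sub h₂ hp0, sub_apply, planarForm_sub]
    -- The coefficients differ between the two surfaces. The error is the difference of the
    -- coefficients applied to a second derivative of `X₂`, hence of order `w₁ - w₂`.
    have e3 : radialFDeriv G w₁ β = radialFDeriv G w₂ β₂ - radialFDeriv G w₁ β₂ := by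
      rw [e2, map_sub, e1]
    have e4 : ‖β₂‖ ≤ 2 * D := by
      refine (norm_planarForm_le _ hna hf.norm_b).trans ?_
      have := (fderiv ℝ (fderiv ℝ X₂) p).le_opNorm a
      rw [hna, mul_one] at this
      have := hDle p hp
      linarith
    rw [e3]
    calc _ ≤ K * ‖w₂ - w₁‖ * ‖β₂‖ := hKle w₂ w₁ β₂ hm₂ hm₁
      _ ≤ K * (M * E) * (2 * D) := by
        rw [norm_sub_rev]
        gcongr
      _ = _ := by ring
  -- second order condition
  set Q := σ • β - z • (w₁ - w₂) + E • ((l * σ ^ 2) • formPart 1 0 0 - z • formPart 1 0 1) with hQ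
  have hQneg : ‖Q.2‖ ≤ -Q.1 := by
    -- Write `e = z p + σ a`. By total symmetry of the second derivative, the `a` component is the
    -- derivative of `Y` in the direction `a`, already controlled by the equation. The `p` component
    -- reduces to `Y` by the differentiated Euler relation.
    have hB : ∀ v u : Space3, (inner ℝ (Y' v u) e : ℝ) =
        σ * inner ℝ (Y' a v) u - z * inner ℝ (Y v) u := fun v u => by
      conv_lhs => rw [hea]
      rw [inner_add_right, real_inner_smul_right, real_inner_smul_right,
        hX.inner_fderiv_fderiv hp0, hX.fderiv_fderiv_apply_self hp0,
        hX.inner_fderiv_fderiv hp0, hX.fderiv_fderiv_comm hp0, ← hY', inner_neg_right,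
        real_inner_comm (Y' a v), real_inner_comm]
      rw [← hY, real_inner_comm]
      ring
    have hsymB : (inner ℝ (Y' a b) a : ℝ) = inner ℝ (Y' a a) b := by
      rw [hY', hX.inner_fderiv_fderiv hp0, real_inner_comm]
    have hYba : (inner ℝ (Y b) a : ℝ) = 0 := by
      rw [hY, hX.symm p hp0, real_inner_comm]; exact hYab
    have hform := norm_formPart_snd_le
      (p := -(σ * inner ℝ (Y' a a) a + z * E + E * (l * σ ^ 2 - z)))
      (q := -(σ * inner ℝ (Y' a a) b)) (r := -(σ * inner ℝ (Y' a b) b - z * w - E * z))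
      fun s t hst => by
        have h2 := (hX.barrier_conditions hp (hf.norm_comb hst) (hf.inner_comb s t) hmax).2
        rw [← hY', hB] at h2
        simp only [map_add, map_smul, inner_add_left, inner_add_right, real_inner_smul_left,
          real_inner_smul_right, hae, hbe, hsymB, hYaa, hYab, hYba, ← hw, ← hz] at h2
        have h3 : ε * Real.exp (l * z) * (l ^ 2 * (s * σ + t * 0) ^ 2 - l * z) =
            E * (l * σ ^ 2) * s ^ 2 - E * z * (s ^ 2 + t ^ 2) := by
          rw [hst, hE]; ring
        rw [h3] at h2
        linarith
    have e1 : (formPart (-(σ * inner ℝ (Y' a a) a + z * E + E * (l * σ ^ 2 - z)))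
        (-(σ * inner ℝ (Y' a a) b)) (-(σ * inner ℝ (Y' a b) b - z * w - E * z))) = -Q := by
      rw [hQ, hdiff, hβ]
      generalize l * σ ^ 2 = k
      refine Prod.ext ?_ (Complex.ext ?_ ?_) <;> simp [planarForm, formPart] <;> ring
    rw [e1] at hform
    simpa using hform
  obtain ⟨hA1, hA2⟩ := hcC w₁ hm₁
  have hN0 : ‖axialGrad G w₁‖ ≤ fderiv ℝ G (w₁.1, ‖w₁.2‖) (1, 0) := by linarith
  have hle := radialFDeriv_nonpos hN0 hQneg
  simp only [hQ, map_add, map_sub, map_smul, smul_eq_mul] at hle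
  have hτ : c / 2 ≤ radialFDeriv G w₁ (formPart 1 0 0) := by
    have := (abs_le.1 (Complex.abs_re_le_norm (axialGrad G w₁))).1
    simp only [radialFDeriv_apply, formPart, Complex.inner, Complex.mul_re, Complex.conj_re,
      Complex.conj_im]
    linarith
  have hι : |radialFDeriv G w₁ (formPart 1 0 1)| ≤ C := by
    have : radialFDeriv G w₁ (formPart 1 0 1) = fderiv ℝ G (w₁.1, ‖w₁.2‖) (1, 0) := by
      simp [radialFDeriv_apply, formPart, Complex.inner]
    rw [this, abs_of_nonneg ((norm_nonneg _).trans hN0)]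
    exact hA2
  have hlω : |radialFDeriv G w₁ (w₁ - w₂)| ≤ 2 * C * M * E :=
    (IsEllipticRadial.abs_radialFDeriv_le hN0 hA2 _).trans
      (by rw [mul_assoc (2 * C)]; gcongr)
  rw [← map_sub] at hle
  have b1 : -(K * M * (2 * D) * E) ≤ σ * radialFDeriv G w₁ β := by
    have h1 : |σ * radialFDeriv G w₁ β| ≤ K * M * (2 * D) * E := by
      rw [abs_mul, abs_of_pos hσ0]
      calc _ ≤ 1 * |radialFDeriv G w₁ β| := by gcongr
        _ ≤ _ := by rw [one_mul]; exact hlβ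
    exact (abs_le.1 h1).1
  have b2 : z * radialFDeriv G w₁ (w₁ - w₂) ≤ 2 * C * M * E := by
    refine (le_abs_self _).trans ?_
    rw [abs_mul]
    calc _ ≤ 1 * |radialFDeriv G w₁ (w₁ - w₂)| := by gcongr
      _ ≤ _ := by rw [one_mul]; exact hlω
  have b3 : z * radialFDeriv G w₁ (formPart 1 0 1) ≤ C := by
    refine (le_abs_self _).trans ?_
    rw [abs_mul]
    calc _ ≤ 1 * |radialFDeriv G w₁ (formPart 1 0 1)| := by gcongr
      _ ≤ _ := by rw [one_mul]; exact hι
  have b4 : l * σ ^ 2 * (c / 2) ≤ l * σ ^ 2 * radialFDeriv G w₁ (formPart 1 0 0) := by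
    gcongr
  -- Every error term carries the factor `E`. It cancels, so the bound on `l` does not depend on
  -- `ε`.
  have b5 : E * (l * σ ^ 2 * (c / 2)) ≤ E * (K * M * (2 * D) + 2 * C * M + C) := by
    have := mul_le_mul_of_nonneg_left b4 hE0.le
    have := mul_le_mul_of_nonneg_left b3 hE0.le
    linarith
  have b6 := le_of_mul_le_mul_left b5 hE0
  rw [← hσ2, div_mul_eq_mul_div, le_div_iff₀ hc]
  linarith

lemma abs_inner_lt_one {x e : Space3} (hx : ‖x‖ = 1) (he : ‖e‖ = 1) (h1 : x ≠ e) (h2 : x ≠ -e) :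
    (inner ℝ x e) ^ 2 < (1 : ℝ) := by
  have hle := abs_real_inner_le_norm x e
  rw [hx, he, one_mul] at hle
  rw [← sq_abs, sq_lt_one_iff₀ (abs_nonneg _)]
  refine lt_of_le_of_ne hle fun h => ?_
  rcases (abs_eq zero_le_one).1 h with h | h
  · exact h1 ((inner_eq_one_iff_of_norm_eq_one hx he).1 h)
  · have : inner ℝ x (-e) = (1 : ℝ) := by rw [inner_neg_right, h, neg_neg]
    exact h2 ((inner_eq_one_iff_of_norm_eq_one hx (by rwa [norm_neg])).1 this)

lemma sphere_subset_compl_zero : Metric.sphere (0 : Space3) 1 ⊆ {0}ᶜ := fun x hx =>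
  ne_zero_of_norm_eq_one (by simpa using hx)

/-- The component of `X₁ - X₂` in the direction `e` takes its maximum at one of the poles `±e`. -/
lemma inner_sub_le_max_pole {G : ℝ × ℝ → ℝ} (hG : IsEllipticRadial G) {X₁ X₂ : Space3 → Space3}
    (h₁ : IsSupportGradient X₁) (h₂ : IsSupportGradient X₂) (hpos₁ : IsTangentiallyPositive X₁)
    (hpos₂ : IsTangentiallyPositive X₂) (heq : HaveEqualCurvature G X₁ X₂) {e x₀ : Space3}
    (he : ‖e‖ = 1) (hx₀ : ‖x₀‖ = 1) :
    (inner ℝ ((X₁ - X₂) x₀) e : ℝ) ≤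
      max (inner ℝ ((X₁ - X₂) e) e) (inner ℝ ((X₁ - X₂) (-e)) e) := by
  obtain ⟨C, hC, hbar⟩ := exists_barrier_bound hG h₁ h₂ hpos₁ hpos₂ heq
  by_contra! hlt
  set v : Space3 → ℝ := fun x => inner ℝ ((X₁ - X₂) x) e with hv
  have hvc : ContinuousOn v (Metric.sphere (0 : Space3) 1) :=
    ((h₁.sub h₂).contDiffOn.continuousOn.mono sphere_subset_compl_zero).inner continuousOn_const
  change max (v e) (v (-e)) < v x₀ at hlt
  obtain ⟨μ, hμ1, hμ2⟩ := exists_between hlt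
  -- The superlevel set at `μ` contains `x₀` but neither pole, so by compactness `1 - ⟪x, e⟫²` has a
  -- positive minimum `δ` on it.
  set A : Set Space3 := Metric.sphere (0 : Space3) 1 ∩ v ⁻¹' Ici μ with hA
  have hAc : IsCompact A := (isCompact_sphere (0 : Space3) 1).of_isClosed_subset
    (hvc.preimage_isClosed_of_isClosed Metric.isClosed_sphere isClosed_Ici) inter_subset_left
  have hx₀A : x₀ ∈ A := ⟨by simpa using hx₀, hμ2.le⟩
  obtain ⟨y, hy, hymin⟩ := hAc.exists_isMinOn ⟨x₀, hx₀A⟩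
    (f := fun x : Space3 => (1 : ℝ) - (inner ℝ x e) ^ 2) (by fun_prop)
  have hy1 : ‖y‖ = 1 := by simpa using hy.1
  have hδ : 0 < 1 - (inner ℝ y e : ℝ) ^ 2 := by
    have := abs_inner_lt_one hy1 he
      (by rintro rfl; exact (lt_of_lt_of_le ((le_max_left _ _).trans_lt hμ1) hy.2).false)
      (by rintro rfl; exact (lt_of_lt_of_le ((le_max_right _ _).trans_lt hμ1) hy.2).false)
    linarith
  set δ := 1 - (inner ℝ y e : ℝ) ^ 2
  -- This `l` violates the bound of `exists_barrier_bound` on all of `A`. The choice of `ε` keeps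
  -- the barrier below `v x₀ - μ`, so that the perturbed maximum point remains in `A`.
  set l := C / δ + 1 with hl
  have hl0 : 0 < l := by positivity
  set ε := (v x₀ - μ) * Real.exp (-l) with hε
  have hε0 : 0 < ε := mul_pos (by linarith) (Real.exp_pos _)
  obtain ⟨p, hp, hpmax⟩ := (isCompact_sphere (0 : Space3) 1).exists_isMaxOn
    ⟨x₀, by simpa using hx₀⟩ (f := fun x => v x + ε * Real.exp (l * inner ℝ x e))
    (hvc.add (by fun_prop))
  have hp1 : ‖p‖ = 1 := by simpa using hp
  have hpe : (inner ℝ p e : ℝ) ≤ 1 := by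
    simpa [hp1, he] using (le_abs_self _).trans (abs_real_inner_le_norm p e)
  have hpA : p ∈ A := by
    refine ⟨hp, ?_⟩
    have h1 : v x₀ + ε * Real.exp (l * inner ℝ x₀ e) ≤ v p + ε * Real.exp (l * inner ℝ p e) :=
      hpmax (a := x₀) (by simpa using hx₀)
    have h2 : ε * Real.exp (l * inner ℝ p e) ≤ v x₀ - μ := by
      calc _ ≤ ε * Real.exp l := by
            gcongr
            nlinarith
        _ = _ := by rw [hε, mul_assoc, ← Real.exp_add, neg_add_cancel, Real.exp_zero, mul_one]
    have h3 : 0 < ε * Real.exp (l * inner ℝ x₀ e) := by positivity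
    show μ ≤ v p
    linarith
  have h1 := hbar p e ε l hp1 he hε0 hl0 fun x hx => hpmax (a := x) (by simpa using hx)
  have h2 : δ ≤ 1 - (inner ℝ p e : ℝ) ^ 2 := hymin hpA
  have h3 : l * δ = C + δ := by rw [hl]; field_simp
  have h4 := mul_le_mul_of_nonneg_left h2 hl0.le
  linarith

/-! ### Constancy of the difference of two support gradients. -/

namespace IsSupportGradient

variable {X X₁ X₂ : Space3 → Space3}

lemma norm_planarForm_snd_lt (h : IsSupportGradient X) (hpos : IsTangentiallyPositive X)
    {x a b : Space3} (hf : IsFrame x a b) :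
    ‖(planarForm (fderiv ℝ X x) a b).2‖ < (planarForm (fderiv ℝ X x) a b).1 := by
  obtain ⟨r, R, hr, hbox⟩ := h.exists_radiiBox hpos
  simpa using radiiBox_subset hr (hbox x a b hf)

lemma fderiv_eq_zero_of_planarForm (h : IsSupportGradient X) {x a b : Space3}
    (hf : IsFrame x a b) (h0 : planarForm (fderiv ℝ X x) a b = 0) : fderiv ℝ X x = 0 := by
  have hx := ne_zero_of_norm_eq_one hf.norm_x
  have h1 : (planarForm (fderiv ℝ X x) a b).1 = 0 := by rw [h0]; rfl
  have h2 : (planarForm (fderiv ℝ X x) a b).2.re = 0 := by rw [h0]; rfl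
  have h3 : (planarForm (fderiv ℝ X x) a b).2.im = 0 := by rw [h0]; rfl
  simp only [planarForm, formPart] at h1 h2 h3
  have haa : (inner ℝ a (fderiv ℝ X x a) : ℝ) = 0 := by rw [real_inner_comm]; linarith
  have hbb : (inner ℝ b (fderiv ℝ X x b) : ℝ) = 0 := by rw [real_inner_comm]; linarith
  have hba : (inner ℝ b (fderiv ℝ X x a) : ℝ) = 0 := by rw [real_inner_comm]; exact h3
  have hab : (inner ℝ a (fderiv ℝ X x b) : ℝ) = 0 := by rw [← h.symm x hx]; exact h3
  have hxv : ∀ v, (inner ℝ x (fderiv ℝ X x v) : ℝ) = 0 := fun v => by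
    rw [← h.symm x hx, h.fderiv_self hx, inner_zero_left]
  have ha : fderiv ℝ X x a = 0 := by rw [hf.expand (hxv a), haa, hba]; simp
  have hb : fderiv ℝ X x b = 0 := by rw [hf.expand (hxv b), hab, hbb]; simp
  ext v : 1
  have hxx : inner ℝ x x = (1 : ℝ) := by rw [real_inner_self_eq_norm_sq, hf.norm_x, one_pow]
  have hv : inner ℝ x (v - (inner ℝ x v : ℝ) • x) = (0 : ℝ) := by
    rw [inner_sub_right, real_inner_smul_right, hxx]; ring
  have h4 := hf.expand hv
  rw [sub_eq_iff_eq_add] at h4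
  rw [h4, map_add, map_add, map_smul, map_smul, map_smul, ha, hb, h.fderiv_self hx]
  simp

/-- A field whose derivative vanishes at the points of the unit sphere is constant. -/
lemma eq_of_fderiv_eq_zero (h : IsSupportGradient X)
    (h0 : ∀ x : Space3, ‖x‖ = 1 → fderiv ℝ X x = 0) :
    ∃ c, ∀ x : Space3, x ≠ 0 → X x = c := by
  have hall : ∀ x : Space3, x ≠ 0 → fderiv ℝ X x = 0 := fun x hx => by
    have hn : 0 < ‖x‖⁻¹ := inv_pos.2 (norm_pos_iff.2 hx)
    rw [fderiv_eq_smul_of_homogeneous hx (h.smul _ hn) (h.hasFDerivAt hx).differentiableAt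
      (h.hasFDerivAt (smul_ne_zero hn.ne' hx)).differentiableAt, h0]
    · ext v : 1
      simp
    · rw [norm_smul, norm_inv, norm_norm, inv_mul_cancel₀ (norm_ne_zero_iff.2 hx)]
  have hconn : IsPreconnected ({0}ᶜ : Set Space3) :=
    (isConnected_compl_singleton_of_one_lt_rank (by
      rw [← Module.finrank_eq_rank, finrank_euclideanSpace_fin]; norm_num) 0).isPreconnected
  obtain ⟨c, hc⟩ := isOpen_compl_singleton.exists_is_const_of_fderiv_eq_zero hconn
    (fun x hx => (h.hasFDerivAt hx).differentiableAt.differentiableWithinAt)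
    (fun x hx => hall x hx)
  exact ⟨c, fun x hx => hc x hx⟩

end IsSupportGradient

lemma IsEllipticRadial.eq_of_norm_sub_le {G : ℝ × ℝ → ℝ} (hG : IsEllipticRadial G)
    {w w' : ℝ × ℂ} (hw : ‖w.2‖ < w.1) (hw' : ‖w'.2‖ < w'.1)
    (heq : G (w.1, ‖w.2‖) = G (w'.1, ‖w'.2‖)) (hle : ‖w.2 - w'.2‖ ≤ w.1 - w'.1) : w = w' := by
  refine hG.eq_of_norm_le (r := min (w.1 - ‖w.2‖) (w'.1 - ‖w'.2‖))
    (R := max (w.1 + ‖w.2‖) (w'.1 + ‖w'.2‖)) (lt_min (by linarith) (by linarith)) ?_ ?_ heq hle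
  · constructor <;> simp
  · constructor <;> simp

section

variable {G : ℝ × ℝ → ℝ} (hG : IsEllipticRadial G) {X₁ X₂ : Space3 → Space3}
  (h₁ : IsSupportGradient X₁) (h₂ : IsSupportGradient X₂) (hpos₁ : IsTangentiallyPositive X₁)
  (hpos₂ : IsTangentiallyPositive X₂) (heq : HaveEqualCurvature G X₁ X₂)
include hG h₁ h₂ hpos₁ hpos₂ heq

/-- The hypothesis is that the determinant is nonnegative, so the difference of the two forms is
semidefinite of one sign. Ellipticity then makes it vanish. -/
lemma fderiv_sub_eq_zero_of_semidefinite {x a b : Space3} (hf : IsFrame x a b)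
    (hle : ‖(planarForm (fderiv ℝ (X₁ - X₂) x) a b).2‖ ≤
      |(planarForm (fderiv ℝ (X₁ - X₂) x) a b).1|) : fderiv ℝ (X₁ - X₂) x = 0 := by
  have hx := ne_zero_of_norm_eq_one hf.norm_x
  refine (h₁.sub h₂).fderiv_eq_zero_of_planarForm hf ?_
  rw [h₁.fderiv_sub h₂ hx, planarForm_sub] at hle ⊢
  have hw₁ := h₁.norm_planarForm_snd_lt hpos₁ hf
  have hw₂ := h₂.norm_planarForm_snd_lt hpos₂ hf
  rw [sub_eq_zero]
  rw [Prod.snd_sub, Prod.fst_sub] at hle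
  rcases abs_cases ((planarForm (fderiv ℝ X₁ x) a b).1 - (planarForm (fderiv ℝ X₂ x) a b).1)
    with ⟨h, -⟩ | ⟨h, -⟩
  · exact hG.eq_of_norm_sub_le hw₁ hw₂ (heq x a b hf) (h ▸ hle)
  · refine (hG.eq_of_norm_sub_le hw₂ hw₁ (heq x a b hf).symm ?_).symm
    rw [norm_sub_rev]
    linarith

/-- For fixed `p`, the function `⟪X p - X y, y⟫` of `y` is at most zero, with equality at `y = p`.
Its second derivative there along a great circle with velocity `a` is `-⟪DX a, a⟫`, so `DX` is
positive semidefinite. -/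
lemma eq_add_const_of_support
    (hsup : ∀ x e : Space3, ‖x‖ = 1 → ‖e‖ = 1 →
      (inner ℝ ((X₁ - X₂) x) e : ℝ) ≤ inner ℝ ((X₁ - X₂) e) e) :
    ∃ c, ∀ x : Space3, x ≠ 0 → (X₁ - X₂) x = c := by
  have hX := h₁.sub h₂
  have hnonneg : ∀ p a : Space3, ‖p‖ = 1 → ‖a‖ = 1 → inner ℝ p a = (0 : ℝ) →
      0 ≤ (inner ℝ (fderiv ℝ (X₁ - X₂) p a) a : ℝ) := fun p a hp ha hpa => by
    set X := X₁ - X₂ with hXdef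
    have hc0 : ∀ s, greatCircle p a s ≠ 0 := fun s =>
      ne_zero_of_norm_eq_one (norm_greatCircle hp ha hpa s)
    have hd : ∀ s, HasDerivAt (fun s => (inner ℝ (X p - X (greatCircle p a s))
        (greatCircle p a s) : ℝ))
        (inner ℝ (X p - X (greatCircle p a s)) (greatCircle a (-p) s)) s := fun s => by
      have h1 := ((hX.hasFDerivAt (hc0 s)).comp_hasDerivAt s (hasDerivAt_greatCircle p a s))
      have h2 := (h1.const_sub (X p)).inner ℝ (hasDerivAt_greatCircle p a s)
      refine h2.congr_deriv ?_
      rw [inner_neg_left, hX.symm _ (hc0 s), hX.fderiv_self (hc0 s), inner_zero_right]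
      simp
    have hd' : HasDerivAt (fun s => (inner ℝ (X p - X (greatCircle p a s))
        (greatCircle a (-p) s) : ℝ)) (-inner ℝ (fderiv ℝ X p a) a) 0 := by
      have h1 := ((hX.hasFDerivAt (hc0 0)).comp_hasDerivAt (0 : ℝ) (hasDerivAt_greatCircle p a 0))
      have h2 := (h1.const_sub (X p)).inner ℝ (hasDerivAt_greatCircle a (-p) 0)
      refine h2.congr_deriv ?_
      simp [greatCircle_zero]
    have hm : IsLocalMax (fun s => (inner ℝ (X p - X (greatCircle p a s))
        (greatCircle p a s) : ℝ)) 0 := Filter.Eventually.of_forall fun s => by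
      have := hsup p _ hp (norm_greatCircle hp ha hpa s)
      simp only [greatCircle_zero, sub_self, inner_zero_left, inner_sub_left]
      linarith
    have := (hm.second_order hd hd').2
    linarith
  refine hX.eq_of_fderiv_eq_zero fun x hx => ?_
  obtain ⟨a, ha, hxa⟩ := exists_unit_perp x
  obtain ⟨b, hf⟩ := exists_isFrame hx ha hxa
  have hx0 := ne_zero_of_norm_eq_one hx
  refine fderiv_sub_eq_zero_of_semidefinite hG h₁ h₂ hpos₁ hpos₂ heq hf
    ((norm_formPart_snd_le fun s t hst => ?_).trans (le_abs_self _))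
  rw [← hX.inner_fderiv_comb hx0]
  exact hnonneg x _ hx (hf.norm_comb hst) (hf.inner_comb s t)

/-- A constant component in the direction `e` makes the form vanish on the tangential part of `e`.
Off the poles its determinant is therefore zero and `fderiv_sub_eq_zero_of_semidefinite` applies;
the poles follow by continuity along a great circle. -/
lemma eq_add_const_of_pole {e : Space3} (he : ‖e‖ = 1)
    (hconst : ∀ x : Space3, ‖x‖ = 1 →
      (inner ℝ ((X₁ - X₂) x) e : ℝ) = inner ℝ ((X₁ - X₂) e) e) :
    ∃ c, ∀ x : Space3, x ≠ 0 → (X₁ - X₂) x = c := by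
  have hX := h₁.sub h₂
  set X := X₁ - X₂ with hXdef
  have hfd : ∀ x : Space3, x ≠ 0 → ∀ v, (inner ℝ (fderiv ℝ X x v) e : ℝ) = 0 := fun x hx v => by
    have h1 := (hX.hasFDerivAt hx).inner ℝ (hasFDerivAt_const e x)
    have h2 : (fun y => (inner ℝ (X y) e : ℝ)) =ᶠ[𝓝 x] fun _ => inner ℝ (X e) e := by
      filter_upwards [eventually_ne_zero hx] with y hy
      have hn : 0 < ‖y‖⁻¹ := inv_pos.2 (norm_pos_iff.2 hy)
      rw [← hX.smul _ hn y hy, hconst]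
      rw [norm_smul, norm_inv, norm_norm, inv_mul_cancel₀ (norm_ne_zero_iff.2 hy)]
    have h3 := DFunLike.congr_fun
      (h1.unique ((hasFDerivAt_const _ x).congr_of_eventuallyEq h2)) v
    simpa using h3
  have hoff : ∀ x : Space3, ‖x‖ = 1 → (inner ℝ x e : ℝ) ^ 2 ≠ 1 → fderiv ℝ X x = 0 :=
      fun x hx hxe => by
    have hx0 := ne_zero_of_norm_eq_one hx
    have hxx : inner ℝ x x = (1 : ℝ) := by rw [real_inner_self_eq_norm_sq, hx, one_pow]
    set d : Space3 := e - (inner ℝ x e : ℝ) • x with hd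
    have hd0 : d ≠ 0 := fun h0 => hxe <| by
      have h1 : inner ℝ e d = (0 : ℝ) := by rw [h0, inner_zero_right]
      rw [hd, inner_sub_right, real_inner_smul_right, real_inner_self_eq_norm_sq, he,
        real_inner_comm x e] at h1
      linarith
    have hxd : inner ℝ x d = (0 : ℝ) := by
      rw [hd, inner_sub_right, real_inner_smul_right, hxx]; ring
    obtain ⟨b, hf⟩ := exists_isFrame (a := ‖d‖⁻¹ • d) hx
      (by rw [norm_smul, norm_inv, norm_norm, inv_mul_cancel₀ (norm_ne_zero_iff.2 hd0)])
      (by rw [real_inner_smul_right, hxd, mul_zero])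
    refine fderiv_sub_eq_zero_of_semidefinite hG h₁ h₂ hpos₁ hpos₂ heq hf ?_
    have hYd : ∀ v, (inner ℝ (fderiv ℝ X x v) (‖d‖⁻¹ • d) : ℝ) = 0 := fun v => by
      rw [real_inner_smul_right, hd, inner_sub_right, hfd x hx0, real_inner_smul_right,
        hX.symm x hx0, hX.fderiv_self hx0, inner_zero_right]
      ring
    have hYb : (inner ℝ (fderiv ℝ X x (‖d‖⁻¹ • d)) b : ℝ) = 0 := by
      rw [hX.symm x hx0, real_inner_comm]; exact hYd b
    rw [← hXdef, planarForm, hYd, hYb, formPart]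
    refine (Complex.norm_le_abs_re_add_abs_im _).trans_eq ?_
    simp [abs_div]
  refine hX.eq_of_fderiv_eq_zero fun x hx => ?_
  by_cases hxe : (inner ℝ x e : ℝ) ^ 2 = 1
  · obtain ⟨a, ha, hxa⟩ := exists_unit_perp x
    have hx0 := ne_zero_of_norm_eq_one hx
    have hea : (inner ℝ a e : ℝ) = 0 := by
      obtain ⟨b, hf⟩ := exists_isFrame hx ha hxa
      have hxx : inner ℝ x x = (1 : ℝ) := by rw [real_inner_self_eq_norm_sq, hx, one_pow]
      have h1 : ‖e - (inner ℝ x e : ℝ) • x‖ ^ 2 = 0 := by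
        rw [← real_inner_self_eq_norm_sq]
        simp only [inner_sub_left, inner_sub_right, real_inner_smul_left, real_inner_smul_right,
          hxx, real_inner_self_eq_norm_sq e, he, real_inner_comm x e]
        linarith
      have h2 : e - (inner ℝ x e : ℝ) • x = 0 := by
        rwa [sq_eq_zero_iff, norm_eq_zero] at h1
      rw [sub_eq_zero.1 h2, real_inner_smul_right, real_inner_comm x a, hxa, mul_zero]
    have hc0 : greatCircle x a 0 ≠ 0 := by rwa [greatCircle_zero]
    have hcont : ContinuousAt (fun s => fderiv ℝ X (greatCircle x a s)) 0 :=
      ContinuousAt.comp (f := greatCircle x a) (hX.hasFDerivAt_fderiv hc0).continuousAt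
        (hasDerivAt_greatCircle x a 0).continuousAt
    have hev : ∀ᶠ s in 𝓝[≠] (0 : ℝ), fderiv ℝ X (greatCircle x a s) = 0 := by
      have h1 : ∀ᶠ s : ℝ in 𝓝[≠] (0 : ℝ), s ∈ Ioo (-Real.pi) Real.pi :=
        nhdsWithin_le_nhds (Ioo_mem_nhds (by linarith [Real.pi_pos]) Real.pi_pos)
      filter_upwards [h1, self_mem_nhdsWithin] with s hs hs0
      refine hoff _ (norm_greatCircle hx ha hxa s) fun h2 => ?_
      rw [greatCircle, inner_add_left, real_inner_smul_left, real_inner_smul_left, hea, mul_zero,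
        add_zero, mul_pow, hxe, mul_one] at h2
      have h3 : Real.sin s = 0 := by
        have := Real.sin_sq_add_cos_sq s
        rw [h2] at this
        exact pow_eq_zero_iff two_ne_zero |>.1 (by linarith)
      exact hs0 ((Real.sin_eq_zero_iff_of_lt_of_lt hs.1 hs.2).1 h3)
    have h1 := hcont.tendsto.mono_left (nhdsWithin_le_nhds (s := {0}ᶜ))
    rw [greatCircle_zero] at h1
    exact tendsto_nhds_unique h1
      (tendsto_const_nhds.congr' (hev.mono fun s hs => hs.symm))
  · exact hoff x hx hxe

/-- Two surfaces with the same curvature function differ by a translation. -/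
theorem sub_eq_const : ∃ c, ∀ x : Space3, x ≠ 0 → (X₁ - X₂) x = c := by
  have hX := h₁.sub h₂
  have hmax : ∀ e x : Space3, ‖e‖ = 1 → ‖x‖ = 1 → (inner ℝ ((X₁ - X₂) x) e : ℝ) ≤
      max (inner ℝ ((X₁ - X₂) e) e) (inner ℝ ((X₁ - X₂) (-e)) e) := fun e x he hx =>
    inner_sub_le_max_pole hG h₁ h₂ hpos₁ hpos₂ heq he hx
  -- The difference of the values of the component `⟪X₁ - X₂, e⟫` at its two poles.
  set k : Space3 → ℝ := fun e => inner ℝ ((X₁ - X₂) e) e - inner ℝ ((X₁ - X₂) (-e)) e with hk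
  have hkc : ContinuousOn k (Metric.sphere (0 : Space3) 1) := by
    have hc := hX.contDiffOn.continuousOn.mono sphere_subset_compl_zero
    refine (hc.inner continuousOn_id).sub (ContinuousOn.inner (hc.comp (by fun_prop) ?_)
      continuousOn_id)
    intro x hx
    simpa using hx
  by_cases h0 : ∃ e : Space3, ‖e‖ = 1 ∧ k e = 0
  · obtain ⟨e, he, hke⟩ := h0
    have hke' := sub_eq_zero.1 hke
    refine eq_add_const_of_pole hG h₁ h₂ hpos₁ hpos₂ heq he fun x hx => le_antisymm ?_ ?_
    · have := hmax e x he hx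
      rwa [← hke', max_self] at this
    -- The maximum principle for `-e` is the minimum principle for `e`.
    · have := hmax (-e) x (by rwa [norm_neg]) hx
      rw [neg_neg, inner_neg_right, inner_neg_right, inner_neg_right, ← hke', max_self] at this
      linarith
  push Not at h0
  have hconn : IsPreconnected (Metric.sphere (0 : Space3) 1) :=
    isPreconnected_sphere (by
      rw [← Module.finrank_eq_rank, finrank_euclideanSpace_fin]; norm_num) 0 1
  have hsign : (∀ e : Space3, ‖e‖ = 1 → 0 < k e) ∨ ∀ e : Space3, ‖e‖ = 1 → k e < 0 := by
    by_contra! hcon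
    obtain ⟨⟨e, he, hke⟩, e', he', hke'⟩ := hcon
    obtain ⟨y, hy, hy0⟩ := hconn.intermediate_value (a := e) (b := e') (by simpa using he)
      (by simpa using he') hkc ⟨hke, hke'⟩
    exact h0 y (by simpa using hy) hy0
  rcases hsign with hs | hs
  · refine eq_add_const_of_support hG h₁ h₂ hpos₁ hpos₂ heq fun x e hx he => ?_
    have h1 := hs e he
    have h2 := hmax e x he hx
    rwa [max_eq_left (sub_pos.1 h1).le] at h2
  -- Exchanging the two surfaces changes the sign of `k`.
  · obtain ⟨c, hc⟩ := eq_add_const_of_support hG h₂ h₁ hpos₂ hpos₁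
      (fun x a b hf => (heq x a b hf).symm) fun x e hx he => by
        have h1 := hs (-e) (by rwa [norm_neg])
        have h2 := hmax (-e) x (by rwa [norm_neg]) hx
        simp only [hk, neg_neg, inner_neg_right] at h1 h2
        rw [max_eq_right (by linarith)] at h2
        have h3 : X₂ - X₁ = -(X₁ - X₂) := by abel
        rw [h3, Pi.neg_apply, Pi.neg_apply, inner_neg_left, inner_neg_left]
        exact h2
    refine ⟨-c, fun x hx => ?_⟩
    rw [← hc x hx, Pi.sub_apply, Pi.sub_apply, neg_sub]

end

/-! ### Supporting planes, tangent planes and outer normals. -/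

lemma inner_sub_neg_of_mem_interior {K : Set Space3} {p n o : Space3} (hn : ‖n‖ = 1)
    (hsup : ∀ y ∈ K, (inner ℝ (y - p) n : ℝ) ≤ 0) (ho : o ∈ interior K) :
    (inner ℝ (o - p) n : ℝ) < 0 := by
  obtain ⟨δ, hδ, hball⟩ := Metric.mem_nhds_iff.1 (mem_interior_iff_mem_nhds.1 ho)
  have hmem : o + (δ / 2) • n ∈ K := hball (by
    rw [Metric.mem_ball, dist_self_add_left, norm_smul, hn, mul_one, Real.norm_of_nonneg
      (by positivity)]
    linarith)
  have h := hsup _ hmem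
  have e : o + (δ / 2) • n - p = (o - p) + (δ / 2) • n := by abel
  rw [e, inner_add_left, real_inner_smul_left, real_inner_self_eq_norm_sq, hn] at h
  linarith

lemma exists_supporting_normal {K : Set Space3} (hconv : Convex ℝ K)
    (hne : (interior K).Nonempty) {p : Space3} (hp : p ∈ frontier K) :
    ∃ n : Space3, ‖n‖ = 1 ∧ ∀ y ∈ K, (inner ℝ (y - p) n : ℝ) ≤ 0 := by
  obtain ⟨f, hf⟩ := geometric_hahn_banach_open_point hconv.interior isOpen_interior hp.2
  set m : Space3 := (InnerProductSpace.toDual ℝ Space3).symm f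
  have hm : ∀ y, inner ℝ y m = f y := fun y => by
    rw [real_inner_comm]; exact InnerProductSpace.toDual_symm_apply
  obtain ⟨o, ho⟩ := hne
  have hm0 : m ≠ 0 := fun h => by
    have h1 := hf o ho
    rw [← hm, ← hm, h, inner_zero_right, inner_zero_right] at h1
    exact h1.false
  have hle : ∀ y ∈ K, f y ≤ f p := fun y hy => by
    have hcl : y ∈ closure (interior K) := by
      rw [hconv.closure_interior_eq_closure_of_nonempty_interior ⟨o, ho⟩]
      exact subset_closure hy
    have hsub : closure (interior K) ⊆ {y | f y ≤ f p} :=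
      closure_minimal (fun z hz => (hf z hz).le) (isClosed_le f.continuous continuous_const)
    exact hsub hcl
  refine ⟨‖m‖⁻¹ • m, ?_, fun y hy => ?_⟩
  · rw [norm_smul, norm_inv, norm_norm, inv_mul_cancel₀ (norm_ne_zero_iff.2 hm0)]
  · rw [real_inner_smul_right, hm, map_sub]
    exact mul_nonpos_of_nonneg_of_nonpos (by positivity) (by linarith [hle y hy])

lemma exists_supporting_point {K : Set Space3} (hK : IsCompact K) (hne : (interior K).Nonempty)
    {n : Space3} (hn : ‖n‖ = 1) : ∃ q ∈ frontier K, ∀ y ∈ K, (inner ℝ (y - q) n : ℝ) ≤ 0 := by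
  obtain ⟨q, hq, hmax⟩ := hK.exists_isMaxOn (hne.mono interior_subset)
    (f := fun y : Space3 => (inner ℝ y n : ℝ)) (by fun_prop)
  have hsup : ∀ y ∈ K, (inner ℝ (y - q) n : ℝ) ≤ 0 := fun y hy => by
    rw [inner_sub_left]
    linarith [show (inner ℝ y n : ℝ) ≤ inner ℝ q n from hmax hy]
  refine ⟨q, ⟨subset_closure hq, fun hint => ?_⟩, hsup⟩
  have := inner_sub_neg_of_mem_interior hn hsup hint
  simp at this

/-- A linear functional which is maximal at a point of a regular level set is a multiple of the
differential of the defining function. -/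
lemma exists_inner_eq_mul_of_support {M U : Set Space3} {g : Space3 → ℝ}
    {g' : Space3 →L[ℝ] ℝ} {p n : Space3} (hU : U ∈ 𝓝 p) (hpM : p ∈ M)
    (hg : HasStrictFDerivAt g g' p) (hg0 : g' ≠ 0) (hM : M ∩ U = {x ∈ U | g x = 0})
    (hsup : ∀ y ∈ M, (inner ℝ (y - p) n : ℝ) ≤ 0) :
    ∃ c : ℝ, ∀ v, inner ℝ v n = c * g' v := by
  have hgp : g p = 0 := by
    have : p ∈ M ∩ U := ⟨hpM, mem_of_mem_nhds hU⟩
    rw [hM] at this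
    exact this.2
  have hextr : IsLocalExtrOn (fun y => innerSL ℝ n y) {x | g x = g p} p := by
    refine Or.inr ?_
    filter_upwards [nhdsWithin_le_nhds hU, self_mem_nhdsWithin] with y hyU hy
    have hyM : y ∈ M ∩ U := by
      rw [hM]; exact ⟨hyU, by rw [← hgp]; exact hy⟩
    have := hsup y hyM.1
    rw [inner_sub_left] at this
    rw [innerSL_apply_apply, innerSL_apply_apply, real_inner_comm, real_inner_comm p]
    linarith
  obtain ⟨a, b, hab, h⟩ := hextr.exists_multipliers_of_hasStrictFDerivAt_1d hg
    (innerSL ℝ n).hasStrictFDerivAt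
  have hv : ∀ v, a * g' v + b * inner ℝ n v = 0 := fun v => by
    simpa using DFunLike.congr_fun h v
  have hb : b ≠ 0 := by
    rintro rfl
    have ha : a ≠ 0 := by
      rintro rfl; exact hab rfl
    apply hg0
    ext v
    have := hv v
    rw [zero_mul, add_zero] at this
    simpa using (mul_eq_zero.1 this).resolve_left ha
  refine ⟨-a / b, fun v => ?_⟩
  rw [real_inner_comm]
  field_simp
  linarith [hv v]

/-- The differential of `g` vanishes on the tangent cone because `g` vanishes on `M` near `p`.
Conversely, the implicit function gives a curve on `M` with any velocity in the kernel. -/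
lemma tangentConeAt_eq_ker {M U : Set Space3} {g : Space3 → ℝ} {g' : Space3 →L[ℝ] ℝ} {p : Space3}
    (hU : U ∈ 𝓝 p) (hpM : p ∈ M) (hg : HasStrictFDerivAt g g' p) (hg0 : g' ≠ 0)
    (hM : M ∩ U = {x ∈ U | g x = 0}) : tangentConeAt ℝ M p = {v | g' v = 0} := by
  have hgp : g p = 0 := by
    have : p ∈ M ∩ U := ⟨hpM, mem_of_mem_nhds hU⟩
    rw [hM] at this
    exact this.2
  ext v
  constructor
  · intro hv
    have h1 : HasFDerivWithinAt g (0 : Space3 →L[ℝ] ℝ) M p := by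
      refine (hasFDerivWithinAt_const (0 : ℝ) p M).congr_of_eventuallyEq ?_ hgp
      filter_upwards [nhdsWithin_le_nhds hU, self_mem_nhdsWithin] with y hyU hyM
      have : y ∈ M ∩ U := ⟨hyM, hyU⟩
      rw [hM] at this
      exact this.2
    exact hg.hasFDerivAt.hasFDerivWithinAt.unique_on h1 hv
  · intro hv
    have hrange : g'.range = ⊤ := by
      rw [LinearMap.range_eq_top]
      exact LinearMap.surjective (fun h => hg0 (by ext v; exact DFunLike.congr_fun h v))
    set φ := hg.implicitFunction g g' hrange with hφ
    set w : g'.ker := ⟨v, hv⟩ with hw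
    have hφ0 : φ (g p) 0 = p := hg.implicitFunction_apply_image hrange
    have hd : HasDerivAt (fun s : ℝ => φ (g p) (s • w)) v 0 := by
      have h1 := (hg.to_implicitFunction hrange).hasFDerivAt
      have h2 : HasDerivAt (fun s : ℝ => s • w) w 0 := by
        simpa using (hasDerivAt_id (0 : ℝ)).smul_const w
      rw [← zero_smul ℝ w] at h1
      exact h1.comp_hasDerivAt (0 : ℝ) h2
    have hcont := hd.continuousAt
    have hzero : ∀ᶠ s : ℝ in 𝓝 0, g (φ (g p) (s • w)) = g p := by
      have h1 := hg.map_implicitFunction_eq hrange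
      have h2 : Filter.Tendsto (fun s : ℝ => (g p, s • w)) (𝓝 0) (𝓝 (g p, 0)) := by
        have : Continuous (fun s : ℝ => (g p, s • w)) := by fun_prop
        simpa using this.tendsto 0
      exact h2.eventually h1
    have hUe : ∀ᶠ s : ℝ in 𝓝 0, φ (g p) (s • w) ∈ U := by
      refine hcont.eventually ?_
      change U ∈ 𝓝 (φ (g p) ((0 : ℝ) • w))
      rwa [zero_smul, hφ0]
    refine mem_tangentConeAt_of_seq (𝓝[≠] (0 : ℝ)) (fun s => s⁻¹)
      (fun s => φ (g p) (s • w) - p) ?_ ?_ ?_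
    · have h1 := hcont.tendsto.sub_const p
      rw [zero_smul, hφ0, sub_self] at h1
      exact h1.mono_left nhdsWithin_le_nhds
    · refine nhdsWithin_le_nhds ?_
      filter_upwards [hzero, hUe] with s h1 h2
      have : φ (g p) (s • w) ∈ M ∩ U := by
        rw [hM]; exact ⟨h2, h1.trans hgp⟩
      rw [add_sub_cancel]
      exact this.1
    · have h1 := hd.tendsto_slope
      refine h1.congr fun s => ?_
      rw [slope_def_module, sub_zero, zero_smul, hφ0]

/-- Both `n` and a supporting normal `m` of `K` are multiples of the differential of a defining
function, so `n = m` or `n = -m`; only the second has to be excluded. -/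
lemma isOuterUnitNormal_iff {K : Set Space3} (hK : IsCompact K) (hconv : Convex ℝ K)
    (hne : (interior K).Nonempty) (hreg : IsRegularSurface 3 (frontier K)) {p n : Space3}
    (hp : p ∈ frontier K) : IsOuterUnitNormal (frontier K) p n ↔
      ‖n‖ = 1 ∧ ∀ y ∈ K, (inner ℝ (y - p) n : ℝ) ≤ 0 := by
  obtain ⟨U, g, hU, hpU, hg, hg0, hM⟩ := hreg p hp
  have hUn := hU.mem_nhds hpU
  have hgs : HasStrictFDerivAt g (fderiv ℝ g p) p :=
    (hg.contDiffAt hUn).hasStrictFDerivAt (by norm_num)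
  have hsub : frontier K ⊆ K := hK.isClosed.frontier_subset
  constructor
  · rintro ⟨hn, -, hsup⟩
    refine ⟨hn, ?_⟩
    obtain ⟨m, hm, hmsup⟩ := exists_supporting_normal hconv hne hp
    obtain ⟨c, hc⟩ := exists_inner_eq_mul_of_support hUn hp hgs (hg0 p hpU) hM hsup
    obtain ⟨d, hd⟩ := exists_inner_eq_mul_of_support hUn hp hgs (hg0 p hpU) hM
      fun y hy => hmsup y (hsub hy)
    have hmm : (1 : ℝ) = d * fderiv ℝ g p m := by
      rw [← hd, real_inner_self_eq_norm_sq, hm, one_pow]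
    have hd0 : d ≠ 0 := by rintro rfl; simp at hmm
    have hcd : ∀ v, inner ℝ v n = c / d * inner ℝ v m := fun v => by
      rw [hc, hd]; field_simp
    have hnm : n = (c / d) • m := ext_inner_left ℝ fun v => by
      rw [hcd, real_inner_smul_right]
    have habs : |c / d| = 1 := by
      rw [hnm, norm_smul, hm, mul_one] at hn; exact hn
    rcases (abs_eq zero_le_one).1 habs with h | h
    · rw [hnm, h, one_smul]; exact hmsup
    -- If `n = -m`, a boundary point `q` extremal in the direction `-m` would lie in the supporting
    -- plane at `p`. All of `K` would then lie in that plane, contrary to the existence of interior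
    -- points.
    · exfalso
      obtain ⟨q, hq, hqsup⟩ := exists_supporting_point hK hne (n := -m) (by rwa [norm_neg])
      obtain ⟨o, ho⟩ := hne
      have h1 := hqsup p (hsub hp)
      have h2 := hqsup o (interior_subset ho)
      have h3 := inner_sub_neg_of_mem_interior hm hmsup ho
      have h4 := hsup q hq
      rw [hnm, h, neg_one_smul] at h4
      simp only [inner_sub_left, inner_neg_right] at h1 h2 h3 h4
      linarith
  · rintro ⟨hn, hsup⟩
    obtain ⟨c, hc⟩ := exists_inner_eq_mul_of_support hUn hp hgs (hg0 p hpU) hM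
      fun y hy => hsup y (hsub hy)
    refine ⟨hn, fun v hv => ?_, fun y hy => hsup y (hsub hy)⟩
    rw [tangentConeAt_eq_ker hUn hp hgs (hg0 p hpU) hM] at hv
    rw [hc, show fderiv ℝ g p v = 0 from hv, mul_zero]

lemma gaussMap_spec {K : Set Space3} (hK : IsCompact K) (hconv : Convex ℝ K)
    (hne : (interior K).Nonempty) (hreg : IsRegularSurface 3 (frontier K)) {p : Space3}
    (hp : p ∈ frontier K) : ‖gaussMap (frontier K) p‖ = 1 ∧
      ∀ y ∈ K, (inner ℝ (y - p) (gaussMap (frontier K) p) : ℝ) ≤ 0 := by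
  have hex : ∃ n, IsOuterUnitNormal (frontier K) p n := by
    obtain ⟨m, hm⟩ := exists_supporting_normal hconv hne hp
    exact ⟨m, (isOuterUnitNormal_iff hK hconv hne hreg hp).2 hm⟩
  rw [← isOuterUnitNormal_iff hK hconv hne hreg hp, gaussMap, dif_pos hex]
  exact hex.choose_spec

/-- The outer unit normal is the normalized gradient of a defining function, if the latter
decreases towards the interior. -/
lemma eq_of_support {K U : Set Space3} (hK : IsCompact K) {g : Space3 → ℝ}
    {g' : Space3 →L[ℝ] ℝ} {p n n' o : Space3} (hU : U ∈ 𝓝 p) (hp : p ∈ frontier K)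
    (hg : HasStrictFDerivAt g g' p) (hM : frontier K ∩ U = {x ∈ U | g x = 0})
    (ho : o ∈ interior K) (hn : ‖n‖ = 1) (hsup : ∀ y ∈ K, (inner ℝ (y - p) n : ℝ) ≤ 0)
    (hn' : ‖n'‖ = 1) {c : ℝ} (hc : 0 < c) (hgn : ∀ v, g' v = c * inner ℝ v n')
    (hgo : g' (o - p) < 0) : n = n' := by
  have hg0 : g' ≠ 0 := by rintro rfl; simp at hgo
  obtain ⟨d, hd⟩ := exists_inner_eq_mul_of_support hU hp hg hg0 hM
    fun y hy => hsup y (hK.isClosed.frontier_subset hy)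
  have h1 := inner_sub_neg_of_mem_interior hn hsup ho
  have hnm : n = (d * c) • n' := ext_inner_left ℝ fun v => by
    rw [hd, hgn, real_inner_smul_right]; ring
  have hd0 : 0 < d := by
    rw [hd] at h1
    by_contra! hneg
    nlinarith
  have h2 : d * c = 1 := by
    rw [hnm, norm_smul, hn', mul_one, Real.norm_of_nonneg (by positivity)] at hn
    exact hn
  rw [hnm, h2, one_smul]

lemma gaussMap_eq {K : Set Space3} (hK : IsCompact K) (hconv : Convex ℝ K)
    (hne : (interior K).Nonempty) (hreg : IsRegularSurface 3 (frontier K)) {p n : Space3}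
    (hp : p ∈ frontier K) (hn : ‖n‖ = 1) (hsup : ∀ y ∈ K, (inner ℝ (y - p) n : ℝ) ≤ 0) :
    gaussMap (frontier K) p = n := by
  obtain ⟨h1, h2⟩ := gaussMap_spec hK hconv hne hreg hp
  obtain ⟨U, g, hU, hpU, hg, hg0, hM⟩ := hreg p hp
  have hUn := hU.mem_nhds hpU
  have hgs : HasStrictFDerivAt g (fderiv ℝ g p) p :=
    (hg.contDiffAt hUn).hasStrictFDerivAt (by norm_num)
  obtain ⟨o, ho⟩ := hne
  have hsub := hK.isClosed.frontier_subset
  obtain ⟨c, hc⟩ := exists_inner_eq_mul_of_support hUn hp hgs (hg0 p hpU) hM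
    fun y hy => hsup y (hsub hy)
  obtain ⟨d, hd⟩ := exists_inner_eq_mul_of_support hUn hp hgs (hg0 p hpU) hM
    fun y hy => h2 y (hsub hy)
  have h3 := inner_sub_neg_of_mem_interior hn hsup ho
  have h4 := inner_sub_neg_of_mem_interior h1 h2 ho
  have hc1 : (1 : ℝ) = c * fderiv ℝ g p n := by
    rw [← hc, real_inner_self_eq_norm_sq, hn, one_pow]
  have hc0 : c ≠ 0 := by rintro rfl; simp at hc1
  have hnm : gaussMap (frontier K) p = (d / c) • n := ext_inner_left ℝ fun v => by
    rw [real_inner_smul_right, hc, hd]; field_simp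
  rw [hnm, norm_smul, hn, mul_one] at h1
  rcases (abs_eq zero_le_one).1 h1 with h | h
  · rw [hnm, h, one_smul]
  · rw [hnm, h, neg_one_smul, inner_neg_right] at h4
    linarith

/-! ### Local extension of the Gauss map. -/

/-- `N` is a `C²` unit vector field on the neighbourhood `V` of `p` which extends the Gauss map of
`M`, where `M ∩ V` is the zero set of `g` and `N` is the normalized gradient of `g`. -/
structure IsLocalGaussMap (M : Set Space3) (p : Space3) (V : Set Space3) (g : Space3 → ℝ)
    (N : Space3 → Space3) : Prop where
  isOpen : IsOpen V
  mem : p ∈ V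
  mem_surface : p ∈ M
  contDiffOn_fun : ContDiffOn ℝ 3 g V
  contDiffOn : ContDiffOn ℝ 2 N V
  norm_eq : ∀ y ∈ V, ‖N y‖ = 1
  fderiv_eq : ∃ c > 0, ∀ v, fderiv ℝ g p v = c * inner ℝ v (N p)
  surface : M ∩ V = {y ∈ V | g y = 0}
  gaussMap_eq : ∀ y ∈ M ∩ V, gaussMap M y = N y
  symm : ∀ u v, inner ℝ u (N p) = (0 : ℝ) → inner ℝ v (N p) = (0 : ℝ) →
    inner ℝ (fderiv ℝ N p u) v = (inner ℝ u (fderiv ℝ N p v) : ℝ)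

lemma isLocalGaussMap_of_neg {K U : Set Space3} (hK : IsCompact K) (hconv : Convex ℝ K)
    (hne : (interior K).Nonempty) (hreg : IsRegularSurface 3 (frontier K)) {p o : Space3}
    {g : Space3 → ℝ} (ho : o ∈ interior K) (hp : p ∈ frontier K) (hU : IsOpen U) (hpU : p ∈ U)
    (hg : ContDiffOn ℝ 3 g U) (hM : frontier K ∩ U = {x ∈ U | g x = 0})
    (hneg : fderiv ℝ g p (o - p) < 0) :
    ∃ V N, IsLocalGaussMap (frontier K) p V g N := by
  set L := (InnerProductSpace.toDual ℝ Space3).symm with hL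
  have hLi : ∀ f v, (inner ℝ (L f) v : ℝ) = f v := fun f v => InnerProductSpace.toDual_symm_apply
  have hgd : ContDiffOn ℝ 2 (fderiv ℝ g) U := hg.fderiv_of_isOpen hU (by norm_num)
  -- On `V` the function `g` decreases towards the interior point `o`, so its gradient is nonzero
  -- and points outwards at boundary points.
  set V := U ∩ (fun y => fderiv ℝ g y (o - y)) ⁻¹' Iio 0 with hV
  have hVo : IsOpen V := by
    refine ContinuousOn.isOpen_inter_preimage ?_ hU isOpen_Iio
    exact hgd.continuousOn.clm_apply (by fun_prop)
  have hVU : V ⊆ U := inter_subset_left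
  have hG0 : ∀ y ∈ V, L (fderiv ℝ g y) ≠ 0 := fun y hy h => by
    have h1 : fderiv ℝ g y (o - y) < 0 := hy.2
    rw [← hLi, h, inner_zero_left] at h1
    exact h1.false
  have hGc : ContDiffOn ℝ 2 (fun y => L (fderiv ℝ g y)) V :=
    L.contDiff.comp_contDiffOn (hgd.mono hVU)
  have hhc : ContDiffOn ℝ 2 (fun y => ‖L (fderiv ℝ g y)‖⁻¹) V :=
    (hGc.norm ℝ hG0).inv fun y hy => norm_ne_zero_iff.2 (hG0 y hy)
  set N : Space3 → Space3 := fun y => ‖L (fderiv ℝ g y)‖⁻¹ • L (fderiv ℝ g y) with hN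
  have hfd : ∀ y ∈ V, ∀ v, fderiv ℝ g y v = ‖L (fderiv ℝ g y)‖ * inner ℝ v (N y) :=
    fun y hy v => by
      rw [hN, real_inner_smul_right, mul_inv_cancel_left₀ (norm_ne_zero_iff.2 (hG0 y hy)),
        real_inner_comm, hLi]
  have hN1 : ∀ y ∈ V, ‖N y‖ = 1 := fun y hy => by
    rw [hN, norm_smul, norm_inv, norm_norm, inv_mul_cancel₀ (norm_ne_zero_iff.2 (hG0 y hy))]
  have hpV : p ∈ V := ⟨hpU, hneg⟩
  have hMV : frontier K ∩ V = {y ∈ V | g y = 0} := by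
    ext y
    constructor
    · rintro ⟨h1, h2⟩
      have : y ∈ frontier K ∩ U := ⟨h1, h2.1⟩
      rw [hM] at this
      exact ⟨h2, this.2⟩
    · rintro ⟨h1, h2⟩
      have : y ∈ frontier K ∩ U := by rw [hM]; exact ⟨h1.1, h2⟩
      exact ⟨this.1, h1⟩
  refine ⟨V, N, hVo, hpV, hp, hg.mono hVU, hhc.smul hGc, hN1,
    ⟨_, norm_pos_iff.2 (hG0 p hpV), hfd p hpV⟩, hMV, fun y hy => ?_, fun u v hu hv => ?_⟩
  · obtain ⟨h1, h2⟩ := gaussMap_spec hK hconv hne hreg hy.1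
    have hgs : HasStrictFDerivAt g (fderiv ℝ g y) y :=
      (hg.contDiffAt (hU.mem_nhds hy.2.1)).hasStrictFDerivAt (by norm_num)
    exact eq_of_support hK (hVo.mem_nhds hy.2) hy.1 hgs hMV ho h1 h2 (hN1 y hy.2)
      (norm_pos_iff.2 (hG0 y hy.2)) (hfd y hy.2) hy.2.2
  · have hVp := hVo.mem_nhds hpV
    have hh : HasFDerivAt (fun y => ‖L (fderiv ℝ g y)‖⁻¹) _ p :=
      ((hhc.contDiffAt hVp).differentiableAt (by norm_num)).hasFDerivAt
    have hd2 : HasFDerivAt (fderiv ℝ g) (fderiv ℝ (fderiv ℝ g) p) p :=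
      (((hgd.mono hVU).contDiffAt hVp).differentiableAt (by norm_num)).hasFDerivAt
    have hNd : HasFDerivAt N (fderiv ℝ N p) p :=
      (((hhc.smul hGc).contDiffAt hVp).differentiableAt (by norm_num)).hasFDerivAt
    have hsymm : IsSymmSndFDerivAt ℝ g p :=
      (hg.contDiffAt (hU.mem_nhds hpU)).isSymmSndFDerivAt (by simp; norm_num)
    -- On tangent vectors the derivative of `N` is the Hessian of `g` divided by the length of the
    -- gradient: the derivative of the normalizing factor multiplies `fderiv ℝ g p v`, which is
    -- zero.
    have hcalc : ∀ u v : Space3, (inner ℝ v (N p) : ℝ) = 0 →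
        (inner ℝ (fderiv ℝ N p u) v : ℝ) =
          ‖L (fderiv ℝ g p)‖⁻¹ * fderiv ℝ (fderiv ℝ g) p u v := fun u v hv => by
      have hv' : fderiv ℝ g p v = 0 := by rw [hfd p hpV, hv, mul_zero]
      have e1 := hNd.inner ℝ (hasFDerivAt_const v p)
      have e2 := hh.mul (hd2.clm_apply (hasFDerivAt_const v p))
      have e3 : (fun y => (inner ℝ (N y) v : ℝ)) =
          fun y => ‖L (fderiv ℝ g y)‖⁻¹ * fderiv ℝ g y v := funext fun y => by
        rw [hN, real_inner_smul_left, hLi]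
      rw [e3] at e1
      have e4 := DFunLike.congr_fun (e1.unique e2) u
      simpa [hv'] using e4
    rw [hcalc u v hv, real_inner_comm, hcalc v u hu, hsymm.eq]

lemma exists_isLocalGaussMap {K : Set Space3} (hK : IsCompact K) (hconv : Convex ℝ K)
    (hne : (interior K).Nonempty) (hreg : IsRegularSurface 3 (frontier K)) {p : Space3}
    (hp : p ∈ frontier K) : ∃ V g N, IsLocalGaussMap (frontier K) p V g N := by
  obtain ⟨U, g, hU, hpU, hg, hg0, hM⟩ := hreg p hp
  obtain ⟨o, ho⟩ := id hne
  obtain ⟨h1, h2⟩ := gaussMap_spec hK hconv hne hreg hp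
  have hUn := hU.mem_nhds hpU
  have hgs : HasStrictFDerivAt g (fderiv ℝ g p) p :=
    (hg.contDiffAt hUn).hasStrictFDerivAt (by norm_num)
  obtain ⟨d, hd⟩ := exists_inner_eq_mul_of_support hUn hp hgs (hg0 p hpU) hM
    fun y hy => h2 y (hK.isClosed.frontier_subset hy)
  have h3 := inner_sub_neg_of_mem_interior h1 h2 ho
  rw [hd] at h3
  rcases lt_trichotomy (fderiv ℝ g p (o - p)) 0 with h | h | h
  · obtain ⟨V, N, hV⟩ := isLocalGaussMap_of_neg hK hconv hne hreg ho hp hU hpU hg hM h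
    exact ⟨V, g, N, hV⟩
  · rw [h, mul_zero] at h3
    exact absurd h3 (lt_irrefl _)
  · obtain ⟨V, N, hV⟩ := isLocalGaussMap_of_neg (g := fun x => -g x) hK hconv hne hreg ho hp hU
      hpU hg.neg (by simpa using hM) (by
        have : fderiv ℝ (fun x => -g x) p = -fderiv ℝ g p := fderiv_fun_neg
        rw [this]
        simpa using h)
    exact ⟨V, _, N, hV⟩

namespace IsLocalGaussMap

variable {M V : Set Space3} {p : Space3} {g : Space3 → ℝ} {N : Space3 → Space3}
  (h : IsLocalGaussMap M p V g N)
include h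

lemma mem_nhds : V ∈ 𝓝 p := h.isOpen.mem_nhds h.mem

lemma hasFDerivAt : HasFDerivAt N (fderiv ℝ N p) p :=
  ((h.contDiffOn.contDiffAt h.mem_nhds).differentiableAt (by norm_num)).hasFDerivAt

lemma hasFDerivAt_fun : HasFDerivAt g (fderiv ℝ g p) p :=
  ((h.contDiffOn_fun.contDiffAt h.mem_nhds).differentiableAt (by norm_num)).hasFDerivAt

lemma fun_eq_zero : g p = 0 := by
  have : p ∈ M ∩ V := ⟨h.mem_surface, h.mem⟩
  rw [h.surface] at this
  exact this.2

lemma mem_tangentConeAt {v : Space3} : v ∈ tangentConeAt ℝ M p ↔ inner ℝ v (N p) = (0 : ℝ) := by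
  obtain ⟨c, hc, hfd⟩ := h.fderiv_eq
  have hg0 : fderiv ℝ g p ≠ 0 := fun h0 => by
    have := hfd (N p)
    rw [h0, real_inner_self_eq_norm_sq, h.norm_eq p h.mem] at this
    simp at this
    exact hc.ne this
  rw [tangentConeAt_eq_ker h.mem_nhds h.mem_surface
    ((h.contDiffOn_fun.contDiffAt h.mem_nhds).hasStrictFDerivAt (by norm_num)) hg0 h.surface]
  show fderiv ℝ g p v = 0 ↔ _
  rw [hfd, mul_eq_zero]
  exact ⟨fun h1 => h1.resolve_left hc.ne', Or.inr⟩

lemma hasFDerivWithinAt : HasFDerivWithinAt (gaussMap M) (fderiv ℝ N p) M p := by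
  refine h.hasFDerivAt.hasFDerivWithinAt.congr_of_eventuallyEq ?_
    (h.gaussMap_eq p ⟨h.mem_surface, h.mem⟩)
  filter_upwards [nhdsWithin_le_nhds h.mem_nhds, self_mem_nhdsWithin] with y hy hyM
  exact h.gaussMap_eq y ⟨hyM, hy⟩

lemma mem_principalCurvatures {κ : ℝ} : κ ∈ principalCurvatures M p ↔
    ∃ v, inner ℝ v (N p) = (0 : ℝ) ∧ v ≠ 0 ∧ fderiv ℝ N p v = κ • v := by
  have heq : EqOn (fderivWithin ℝ (gaussMap M) M p) (fderiv ℝ N p) (tangentConeAt ℝ M p) :=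
    h.hasFDerivWithinAt.differentiableWithinAt.hasFDerivWithinAt.unique_on h.hasFDerivWithinAt
  constructor
  · rintro ⟨v, hv, hv0, he⟩
    exact ⟨v, h.mem_tangentConeAt.1 hv, hv0, by rw [← heq hv, he]⟩
  · rintro ⟨v, hv, hv0, he⟩
    have hv' := h.mem_tangentConeAt.2 hv
    exact ⟨v, hv', hv0, by rw [heq hv', he]⟩

lemma inner_fderiv (v : Space3) : inner ℝ (fderiv ℝ N p v) (N p) = (0 : ℝ) := by
  have h1 := h.hasFDerivAt.inner ℝ h.hasFDerivAt
  have h2 : (fun y => (inner ℝ (N y) (N y) : ℝ)) =ᶠ[𝓝 p] fun _ => 1 := by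
    filter_upwards [h.mem_nhds] with y hy
    rw [real_inner_self_eq_norm_sq, h.norm_eq y hy, one_pow]
  have h3 := DFunLike.congr_fun (h1.unique ((hasFDerivAt_const _ p).congr_of_eventuallyEq h2)) v
  simp only [ContinuousLinearMap.comp_apply, ContinuousLinearMap.prod_apply,
    fderivInnerCLM_apply, zero_apply, real_inner_comm (N p)] at h3
  rw [real_inner_comm]
  linarith

end IsLocalGaussMap

/-! ### Regularity of the inverse Gauss map. -/

/-- The inverse Gauss map, extended to be homogeneous of degree zero. -/
noncomputable def gaussParam (M : Set Space3) (x : Space3) : Space3 :=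
  inverseGaussMap M (‖x‖⁻¹ • x)

lemma norm_inv_norm_smul {x : Space3} (hx : x ≠ 0) : ‖‖x‖⁻¹ • x‖ = 1 := by
  rw [norm_smul, norm_inv, norm_norm, inv_mul_cancel₀ (norm_ne_zero_iff.2 hx)]

lemma gaussParam_of_norm_eq_one (M : Set Space3) {x : Space3} (hx : ‖x‖ = 1) :
    gaussParam M x = inverseGaussMap M x := by
  rw [gaussParam, hx, inv_one, one_smul]

lemma gaussParam_smul (M : Set Space3) {c : ℝ} (hc : 0 < c) (x : Space3) :
    gaussParam M (c • x) = gaussParam M x := by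
  rw [gaussParam, gaussParam, norm_smul, Real.norm_of_nonneg hc.le, smul_smul, mul_inv]
  congr 2
  field_simp

/-- The map `(1 + g) N` turns the Gauss map into a local diffeomorphism of space. Its derivative is
injective because the component along `N p` detects `fderiv ℝ g p v`, and on the tangent plane it is
the shape operator, whose kernel is trivial by `h0`. -/
lemma IsLocalGaussMap.exists_fderiv_eq {M V : Set Space3} {p : Space3} {g : Space3 → ℝ}
    {N : Space3 → Space3} (h : IsLocalGaussMap M p V g N) (h0 : (0 : ℝ) ∉ principalCurvatures M p) :
    ∃ f' : Space3 ≃L[ℝ] Space3,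
      HasFDerivAt (fun y => (1 + g y) • N y) (f' : Space3 →L[ℝ] Space3) p ∧
      ∀ v, f' v = fderiv ℝ N p v + fderiv ℝ g p v • N p := by
  have hd : HasFDerivAt (fun y => (1 + g y) • N y)
      (fderiv ℝ N p + (fderiv ℝ g p).smulRight (N p)) p := by
    have := (h.hasFDerivAt_fun.const_add 1).smul h.hasFDerivAt
    refine this.congr_fderiv ?_
    rw [h.fun_eq_zero, add_zero, one_smul]
  set A := fderiv ℝ N p + (fderiv ℝ g p).smulRight (N p) with hA
  have hAv : ∀ v, A v = fderiv ℝ N p v + fderiv ℝ g p v • N p := fun v => rfl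
  obtain ⟨c, hc, hfd⟩ := h.fderiv_eq
  have hinj : Function.Injective A := by
    rw [injective_iff_map_eq_zero]
    intro v hv
    by_contra hv0
    rw [hAv] at hv
    have h1 : inner ℝ (fderiv ℝ N p v + fderiv ℝ g p v • N p) (N p) = (0 : ℝ) := by
      rw [hv, inner_zero_left]
    rw [inner_add_left, h.inner_fderiv, real_inner_smul_left, real_inner_self_eq_norm_sq,
      h.norm_eq p h.mem] at h1
    have h2 : fderiv ℝ g p v = 0 := by linarith
    rw [h2, zero_smul, add_zero] at hv
    rw [hfd] at h2
    exact h0 (h.mem_principalCurvatures.2 ⟨v, (mul_eq_zero.1 h2).resolve_left hc.ne', hv0,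
      by rw [hv, zero_smul]⟩)
  exact ⟨(LinearEquiv.ofInjectiveEndo (A : Space3 →ₗ[ℝ] Space3) hinj).toContinuousLinearEquiv,
    hd, hAv⟩

section

variable {K : Set Space3} (hK : IsCompact K) (hconv : Convex ℝ K) (hne : (interior K).Nonempty)
  (hreg : IsRegularSurface 3 (frontier K))

include hK hconv hne hreg

lemma gaussMap_surjOn {x : Space3} (hx : ‖x‖ = 1) :
    ∃ p ∈ frontier K, gaussMap (frontier K) p = x := by
  obtain ⟨q, hq, hsup⟩ := exists_supporting_point hK hne hx
  exact ⟨q, hq, gaussMap_eq hK hconv hne hreg hq hx hsup⟩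

lemma inverseGaussMap_mem {x : Space3} (hx : ‖x‖ = 1) :
    inverseGaussMap (frontier K) x ∈ frontier K :=
  Function.invFunOn_mem (gaussMap_surjOn hK hconv hne hreg hx)

lemma gaussMap_inverseGaussMap {x : Space3} (hx : ‖x‖ = 1) :
    gaussMap (frontier K) (inverseGaussMap (frontier K) x) = x :=
  Function.invFunOn_eq (gaussMap_surjOn hK hconv hne hreg hx)

variable (hcurv : ∀ p ∈ frontier K, ∀ κ ∈ principalCurvatures (frontier K) p, 0 < κ)
include hcurv

/-- Two points with the same normal lie in one supporting plane, so the segment between them lies in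
the surface and has constant normal. Its direction would have principal curvature zero. -/
lemma gaussMap_injOn : InjOn (gaussMap (frontier K)) (frontier K) := by
  intro p hp q hq hpq
  by_contra hne'
  have hsub := hK.isClosed.frontier_subset
  obtain ⟨hn, hp1⟩ := gaussMap_spec hK hconv hne hreg hp
  obtain ⟨-, hq1⟩ := gaussMap_spec hK hconv hne hreg hq
  rw [← hpq] at hq1
  set n := gaussMap (frontier K) p with hndef
  have heq : (inner ℝ (q - p) n : ℝ) = 0 := by
    have h1 := hp1 q (hsub hq)
    have h2 := hq1 p (hsub hp)
    rw [inner_sub_left] at h1 h2 ⊢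
    linarith
  have hseg : ∀ y ∈ segment ℝ p q, y ∈ frontier K ∧ gaussMap (frontier K) y = n := by
    intro y hy
    have hyK : y ∈ K := hconv.segment_subset (hsub hp) (hsub hq) hy
    have hyn : (inner ℝ (y - p) n : ℝ) = 0 := by
      obtain ⟨a, b, -, -, hab, rfl⟩ := hy
      have e : a • p + b • q - p = b • (q - p) := by
        have : a = 1 - b := by linarith
        rw [this]; module
      rw [e, real_inner_smul_left, heq, mul_zero]
    have hyf : y ∈ frontier K := ⟨subset_closure hyK, fun hint =>
      (inner_sub_neg_of_mem_interior hn hp1 hint).ne hyn⟩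
    refine ⟨hyf, gaussMap_eq hK hconv hne hreg hyf hn fun z hz => ?_⟩
    have h1 := hp1 z hz
    rw [inner_sub_left] at h1 hyn ⊢
    linarith
  obtain ⟨V, g, N, h⟩ := exists_isLocalGaussMap hK hconv hne hreg hp
  have hmem : q - p ∈ tangentConeAt ℝ (segment ℝ p q) p :=
    mem_tangentConeAt_of_segment_subset Subset.rfl
  have hd := h.hasFDerivWithinAt.mono (fun y hy => (hseg y hy).1)
  have hd0 : HasFDerivWithinAt (gaussMap (frontier K)) (0 : Space3 →L[ℝ] Space3)
      (segment ℝ p q) p :=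
    (hasFDerivWithinAt_const n p _).congr (fun y hy => (hseg y hy).2) rfl
  have h1 : fderiv ℝ N p (q - p) = 0 := hd.unique_on hd0 hmem
  have h2 : inner ℝ (q - p) (N p) = (0 : ℝ) :=
    h.mem_tangentConeAt.1 (tangentConeAt_mono (fun y hy => (hseg y hy).1) hmem)
  have h3 := hcurv p hp 0 (h.mem_principalCurvatures.2
    ⟨q - p, h2, sub_ne_zero.2 (Ne.symm hne'), by rw [h1, zero_smul]⟩)
  exact h3.false

lemma inverseGaussMap_gaussMap {p : Space3} (hp : p ∈ frontier K) :
    inverseGaussMap (frontier K) (gaussMap (frontier K) p) = p := by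
  have hn := (gaussMap_spec hK hconv hne hreg hp).1
  exact gaussMap_injOn hK hconv hne hreg hcurv (inverseGaussMap_mem hK hconv hne hreg hn) hp
    (gaussMap_inverseGaussMap hK hconv hne hreg hn)

/-- Near `p` the vector `(1 + g y) • N y` has length one exactly when `g y = 0`, that is, when `y`
is on the surface. Hence the local inverse of this map restricts to the inverse Gauss map on the
unit sphere. -/
lemma contDiffAt_gaussParam {x : Space3} (hx : x ≠ 0) :
    ContDiffAt ℝ 2 (gaussParam (frontier K)) x := by
  set x₀ := ‖x‖⁻¹ • x with hx₀
  have hx₀1 : ‖x₀‖ = 1 := norm_inv_norm_smul hx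
  set p := inverseGaussMap (frontier K) x₀
  have hp : p ∈ frontier K := inverseGaussMap_mem hK hconv hne hreg hx₀1
  have hpx : gaussMap (frontier K) p = x₀ := gaussMap_inverseGaussMap hK hconv hne hreg hx₀1
  obtain ⟨V, g, N, h⟩ := exists_isLocalGaussMap hK hconv hne hreg hp
  obtain ⟨f', hf', -⟩ := h.exists_fderiv_eq fun h0 => (hcurv p hp 0 h0).false
  have hN : N p = x₀ := by rw [← h.gaussMap_eq p ⟨hp, h.mem⟩, hpx]
  have hΦ : ContDiffAt ℝ 2 (fun y => (1 + g y) • N y) p :=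
    (contDiffAt_const.add ((h.contDiffOn_fun.contDiffAt h.mem_nhds).of_le (by norm_num))).smul
      (h.contDiffOn.contDiffAt h.mem_nhds)
  have hΦp : (1 + g p) • N p = x₀ := by rw [h.fun_eq_zero, add_zero, one_smul, hN]
  set Ψ := hΦ.localInverse hf' two_ne_zero with hΨdef
  have hΨ : ContDiffAt ℝ 2 Ψ x₀ := hΦp ▸ hΦ.to_localInverse hf' two_ne_zero
  have hΨ0 : Ψ x₀ = p := by
    have := hΦ.localInverse_apply_image hf' two_ne_zero
    simp only [hΦp] at this
    exact this
  have hright : ∀ᶠ y in 𝓝 x₀, (1 + g (Ψ y)) • N (Ψ y) = y := by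
    have := (hΦ.hasStrictFDerivAt' hf' two_ne_zero).eventually_right_inverse
    simp only [hΦp] at this
    exact this
  have hΨt : Filter.Tendsto Ψ (𝓝 x₀) (𝓝 p) := by
    have := hΨ.continuousAt.tendsto
    rwa [hΨ0] at this
  have hgt : ∀ᶠ y in 𝓝 p, -1 < g y := by
    have h1 := h.hasFDerivAt_fun.continuousAt.tendsto
    rw [h.fun_eq_zero] at h1
    exact h1.eventually (lt_mem_nhds (by norm_num))
  have hloc : ∀ᶠ y in 𝓝 x₀, ‖y‖ = 1 → inverseGaussMap (frontier K) y = Ψ y := by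
    filter_upwards [hright, hΨt.eventually hgt, hΨt.eventually h.mem_nhds] with y h1 h2 h3 hy
    have h4 : g (Ψ y) = 0 := by
      have h5 := congrArg norm h1
      rw [norm_smul, h.norm_eq _ h3, mul_one, hy, Real.norm_of_nonneg (by linarith)] at h5
      linarith
    have h5 : Ψ y ∈ frontier K ∩ V := by
      rw [h.surface]; exact ⟨h3, h4⟩
    have h6 : gaussMap (frontier K) (Ψ y) = y := by
      rw [h.gaussMap_eq _ h5]
      rwa [h4, add_zero, one_smul] at h1
    conv_lhs => rw [← h6]
    exact inverseGaussMap_gaussMap hK hconv hne hreg hcurv h5.1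
  have hnorm : ContDiffAt ℝ 2 (fun y : Space3 => ‖y‖⁻¹ • y) x :=
    ((contDiffAt_norm ℝ hx).inv (norm_ne_zero_iff.2 hx)).smul contDiffAt_id
  have hcomp : ContDiffAt ℝ 2 (fun y : Space3 => Ψ (‖y‖⁻¹ • y)) x := hΨ.comp x hnorm
  refine hcomp.congr_of_eventuallyEq ?_
  filter_upwards [hnorm.continuousAt.tendsto.eventually hloc, eventually_ne_zero hx] with y hy hy0
  exact hy (norm_inv_norm_smul hy0)

end

/-! ### Principal curvatures as reciprocals of the eigenvalues. -/

/-- The eigenvalues of a symmetric `2 × 2` matrix. -/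
lemma planar_eigenvalue_iff {p q r ρ μ : ℝ} (hρ : ρ ^ 2 = ((p - r) / 2) ^ 2 + q ^ 2) :
    (∃ s t : ℝ, (s, t) ≠ 0 ∧ p * s + q * t = μ * s ∧ q * s + r * t = μ * t) ↔
      μ = (p + r) / 2 + ρ ∨ μ = (p + r) / 2 - ρ := by
  have hdet : (μ - p) * (μ - r) = q ^ 2 ↔ μ = (p + r) / 2 + ρ ∨ μ = (p + r) / 2 - ρ := by
    have h1 : (μ - p) * (μ - r) = q ^ 2 ↔ (μ - ((p + r) / 2 + ρ)) * (μ - ((p + r) / 2 - ρ)) = 0 := by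
      constructor <;> intro h <;> linarith
    rw [h1, mul_eq_zero, sub_eq_zero, sub_eq_zero]
  rw [← hdet]
  constructor
  · rintro ⟨s, t, hst, h1, h2⟩
    have e1 : ((μ - p) * (μ - r) - q ^ 2) * s = 0 := by linear_combination (r - μ) * h1 - q * h2
    have e2 : ((μ - p) * (μ - r) - q ^ 2) * t = 0 := by linear_combination (p - μ) * h2 - q * h1
    rcases mul_eq_zero.1 e1 with h | hs
    · linarith
    rcases mul_eq_zero.1 e2 with h | ht
    · linarith
    exact absurd (by rw [hs, ht]; rfl) hst
  · intro h
    by_cases hq : q = 0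
    · rw [hq, zero_pow two_ne_zero, mul_eq_zero] at h
      rcases h with h | h
      · exact ⟨1, 0, by simp, by linarith, by simp [hq]⟩
      · exact ⟨0, 1, by simp, by simp [hq], by linarith⟩
    · exact ⟨q, μ - p, by simp [hq], by ring, by linear_combination -h⟩

lemma IsFrame.eigenvalue_iff {x a b : Space3} (hf : IsFrame x a b) {W : Space3 →L[ℝ] Space3}
    (hsymm : ∀ u v, inner ℝ (W u) v = (inner ℝ u (W v) : ℝ)) (hWx : W x = 0) {μ : ℝ} :
    (∃ v, inner ℝ x v = (0 : ℝ) ∧ v ≠ 0 ∧ W v = μ • v) ↔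
      μ = (planarForm W a b).1 + ‖(planarForm W a b).2‖ ∨
        μ = (planarForm W a b).1 - ‖(planarForm W a b).2‖ := by
  have hρ : ‖(planarForm W a b).2‖ ^ 2 =
      (((inner ℝ (W a) a : ℝ) - inner ℝ (W b) b) / 2) ^ 2 + (inner ℝ (W a) b : ℝ) ^ 2 := by
    rw [← Complex.normSq_eq_norm_sq, Complex.normSq_apply]
    simp only [planarForm, formPart]
    ring
  have hm : (planarForm W a b).1 = ((inner ℝ (W a) a : ℝ) + inner ℝ (W b) b) / 2 := rfl
  rw [hm, ← planar_eigenvalue_iff hρ]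
  have hWv : ∀ v, inner ℝ x (W v) = (0 : ℝ) := fun v => by rw [← hsymm, hWx, inner_zero_left]
  have haa : inner ℝ a a = (1 : ℝ) := by rw [real_inner_self_eq_norm_sq, hf.norm_a, one_pow]
  have hbb : inner ℝ b b = (1 : ℝ) := by rw [real_inner_self_eq_norm_sq, hf.norm_b, one_pow]
  have hba : inner ℝ b a = (0 : ℝ) := by rw [real_inner_comm]; exact hf.inner_ab
  have hWba : (inner ℝ (W b) a : ℝ) = inner ℝ (W a) b := by rw [hsymm, real_inner_comm]
  have hva : ∀ s t : ℝ, (inner ℝ a (W (s • a + t • b)) : ℝ) =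
      inner ℝ (W a) a * s + inner ℝ (W a) b * t := fun s t => by
    rw [← hsymm, inner_add_right, real_inner_smul_right, real_inner_smul_right]; ring
  have hvb : ∀ s t : ℝ, (inner ℝ b (W (s • a + t • b)) : ℝ) =
      inner ℝ (W a) b * s + inner ℝ (W b) b * t := fun s t => by
    rw [← hsymm, inner_add_right, real_inner_smul_right, real_inner_smul_right, hWba]; ring
  have ha : ∀ s t : ℝ, (inner ℝ a (s • a + t • b) : ℝ) = s := fun s t => by
    rw [inner_add_right, real_inner_smul_right, real_inner_smul_right, haa, hf.inner_ab]; ring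
  have hb : ∀ s t : ℝ, (inner ℝ b (s • a + t • b) : ℝ) = t := fun s t => by
    rw [inner_add_right, real_inner_smul_right, real_inner_smul_right, hbb, hba]; ring
  constructor
  · rintro ⟨v, hxv, hv0, hv⟩
    have he := hf.expand hxv
    set s : ℝ := inner ℝ a v
    set t : ℝ := inner ℝ b v
    refine ⟨s, t, fun h => hv0 ?_, ?_, ?_⟩
    · obtain ⟨h1, h2⟩ := Prod.mk_eq_zero.1 h
      rw [he, h1, h2, zero_smul, zero_smul, add_zero]
    · rw [← hva, ← he, hv, real_inner_smul_right]
    · rw [← hvb, ← he, hv, real_inner_smul_right]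
  · rintro ⟨s, t, hst, h1, h2⟩
    refine ⟨s • a + t • b, hf.inner_comb s t, fun h0 => hst ?_, ?_⟩
    · refine Prod.mk_eq_zero.2 ⟨?_, ?_⟩
      · rw [← ha s t, h0, inner_zero_right]
      · rw [← hb s t, h0, inner_zero_right]
    · rw [hf.expand (hWv _), hva, hvb, h1, h2, smul_add, smul_smul, smul_smul]

section

variable {K : Set Space3} (hK : IsCompact K) (hconv : Convex ℝ K) (hne : (interior K).Nonempty)
  (hreg : IsRegularSurface 3 (frontier K))
  (hcurv : ∀ p ∈ frontier K, ∀ κ ∈ principalCurvatures (frontier K) p, 0 < κ)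

include hK hconv hne hreg hcurv

lemma hasFDerivAt_gaussParam {x : Space3} (hx : x ≠ 0) :
    HasFDerivAt (gaussParam (frontier K)) (fderiv ℝ (gaussParam (frontier K)) x) x :=
  ((contDiffAt_gaussParam hK hconv hne hreg hcurv hx).differentiableAt two_ne_zero).hasFDerivAt

lemma fderiv_gaussParam_self {x : Space3} (hx : x ≠ 0) :
    fderiv ℝ (gaussParam (frontier K)) x x = 0 :=
  (hasFDerivAt_gaussParam hK hconv hne hreg hcurv hx).apply_self_of_homogeneous
    fun _ hc => gaussParam_smul _ hc x

/-- On the tangent plane, the derivative of the inverse Gauss map is a symmetric inverse of the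
shape operator. -/
lemma exists_shapeOperator {x : Space3} (hx : ‖x‖ = 1) : ∃ S : Space3 →L[ℝ] Space3,
    (∀ v, inner ℝ x (S v) = (0 : ℝ)) ∧
    (∀ u, inner ℝ x u = (0 : ℝ) → ∃ v, inner ℝ x v = (0 : ℝ) ∧ S v = u) ∧
    (∀ u v, inner ℝ x u = (0 : ℝ) → inner ℝ x v = (0 : ℝ) →
      inner ℝ (S u) v = (inner ℝ u (S v) : ℝ)) ∧
    (∀ v, inner ℝ x v = (0 : ℝ) → fderiv ℝ (gaussParam (frontier K)) x (S v) = v) ∧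
    ∀ κ, κ ∈ principalCurvatures (frontier K) (gaussParam (frontier K) x) ↔
      ∃ v, inner ℝ x v = (0 : ℝ) ∧ v ≠ 0 ∧ S v = κ • v := by
  have hXx := gaussParam_of_norm_eq_one (frontier K) hx
  set p := gaussParam (frontier K) x with hpdef
  have hp : p ∈ frontier K := hXx ▸ inverseGaussMap_mem hK hconv hne hreg hx
  have hpx : gaussMap (frontier K) p = x := hXx ▸ gaussMap_inverseGaussMap hK hconv hne hreg hx
  obtain ⟨V, g, N, h⟩ := exists_isLocalGaussMap hK hconv hne hreg hp
  have hN : N p = x := by rw [← h.gaussMap_eq p ⟨hp, h.mem⟩, hpx]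
  obtain ⟨f', -, hf'⟩ := h.exists_fderiv_eq fun h0 => (hcurv p hp 0 h0).false
  obtain ⟨c, hc, hfd⟩ := h.fderiv_eq
  have hS : ∀ v, inner ℝ x (fderiv ℝ N p v) = (0 : ℝ) := fun v => by
    rw [real_inner_comm, ← hN]; exact h.inner_fderiv v
  refine ⟨fderiv ℝ N p, hS, fun u hu => ?_, fun u v hu hv => ?_, fun v hv => ?_, fun κ => ?_⟩
  · obtain ⟨v, rfl⟩ := f'.surjective u
    have h1 : fderiv ℝ g p v = 0 := by
      rw [hf', inner_add_right, hS, real_inner_smul_right, hN, real_inner_self_eq_norm_sq, hx]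
        at hu
      linarith
    refine ⟨v, ?_, by rw [hf', h1, zero_smul, add_zero]⟩
    rw [hfd, hN, real_inner_comm] at h1
    exact (mul_eq_zero.1 h1).resolve_left hc.ne'
  · refine h.symm u v ?_ ?_ <;> rw [hN, real_inner_comm] <;> assumption
  · have hXN : HasFDerivAt (gaussParam (frontier K) ∘ N)
        ((fderiv ℝ (gaussParam (frontier K)) x).comp (fderiv ℝ N p)) p := by
      have := hasFDerivAt_gaussParam hK hconv hne hreg hcurv (ne_zero_of_norm_eq_one hx)
      rw [← hN] at this ⊢
      exact this.comp p h.hasFDerivAt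
    have hid : HasFDerivWithinAt (gaussParam (frontier K) ∘ N) (.id ℝ Space3) (frontier K) p := by
      have hval : ∀ y ∈ frontier K ∩ V, (gaussParam (frontier K) ∘ N) y = y := fun y hy => by
        rw [Function.comp_apply, gaussParam_of_norm_eq_one _ (h.norm_eq y hy.2),
          ← h.gaussMap_eq y hy]
        exact inverseGaussMap_gaussMap hK hconv hne hreg hcurv hy.1
      refine (hasFDerivWithinAt_id p _).congr_of_eventuallyEq ?_ (hval p ⟨hp, h.mem⟩)
      filter_upwards [nhdsWithin_le_nhds h.mem_nhds, self_mem_nhdsWithin] with y hy hyM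
      exact hval y ⟨hyM, hy⟩
    refine hXN.hasFDerivWithinAt.unique_on hid (h.mem_tangentConeAt.2 ?_)
    rw [hN, real_inner_comm]; exact hv
  · rw [h.mem_principalCurvatures]
    simp only [hN, real_inner_comm x]

/-- On the unit sphere the derivative kills `x` and inverts the symmetric shape operator on the
tangent plane. Homogeneity carries symmetry to all nonzero `x`. -/
lemma fderiv_gaussParam_symm {x : Space3} (hx : x ≠ 0) (a b : Space3) :
    inner ℝ (fderiv ℝ (gaussParam (frontier K)) x a) b =
      (inner ℝ a (fderiv ℝ (gaussParam (frontier K)) x b) : ℝ) := by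
  have hunit : ∀ x : Space3, ‖x‖ = 1 → ∀ a b,
      inner ℝ (fderiv ℝ (gaussParam (frontier K)) x a) b =
        (inner ℝ a (fderiv ℝ (gaussParam (frontier K)) x b) : ℝ) := fun x hx a b => by
    have hx0 := ne_zero_of_norm_eq_one hx
    obtain ⟨S, hS, hsurj, hsymm, hinv, -⟩ := exists_shapeOperator hK hconv hne hreg hcurv hx
    have hXx := fderiv_gaussParam_self hK hconv hne hreg hcurv hx0
    set W := fderiv ℝ (gaussParam (frontier K)) x
    have hxx : inner ℝ x x = (1 : ℝ) := by rw [real_inner_self_eq_norm_sq, hx, one_pow]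
    have hdec : ∀ a : Space3, ∃ v, inner ℝ x v = (0 : ℝ) ∧ a = S v + (inner ℝ x a : ℝ) • x :=
      fun a => by
        obtain ⟨v, hv, hSv⟩ := hsurj (a - (inner ℝ x a : ℝ) • x)
          (by rw [inner_sub_right, real_inner_smul_right, hxx]; ring)
        exact ⟨v, hv, by rw [hSv]; abel⟩
    obtain ⟨u, hu, hau⟩ := hdec a
    obtain ⟨v, hv, hbv⟩ := hdec b
    have hux : inner ℝ u x = (0 : ℝ) := by rw [real_inner_comm]; exact hu
    have e1 : W a = u := by rw [hau, map_add, map_smul, hXx, smul_zero, add_zero, hinv u hu]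
    have e2 : W b = v := by rw [hbv, map_add, map_smul, hXx, smul_zero, add_zero, hinv v hv]
    rw [e1, e2, hau, hbv, inner_add_right, inner_add_left, real_inner_smul_right,
      real_inner_smul_left, hux, hv, mul_zero, mul_zero, add_zero, add_zero, hsymm u v hu hv]
  have hn : 0 < ‖x‖⁻¹ := inv_pos.2 (norm_pos_iff.2 hx)
  rw [fderiv_eq_smul_of_homogeneous hx (fun y _ => gaussParam_smul _ hn y)
    (hasFDerivAt_gaussParam hK hconv hne hreg hcurv hx).differentiableAt
    (hasFDerivAt_gaussParam hK hconv hne hreg hcurv (smul_ne_zero hn.ne' hx)).differentiableAt]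
  have := hunit _ (norm_inv_norm_smul hx) a b
  simp only [smul_apply, real_inner_smul_left, real_inner_smul_right, this]

lemma isSupportGradient_gaussParam : IsSupportGradient (gaussParam (frontier K)) where
  contDiffOn _ hx := (contDiffAt_gaussParam hK hconv hne hreg hcurv hx).contDiffWithinAt
  smul _ hc x _ := gaussParam_smul _ hc x
  symm _ hx a b := fderiv_gaussParam_symm hK hconv hne hreg hcurv hx a b

lemma mem_principalCurvatures_gaussParam {x : Space3} (hx : ‖x‖ = 1) {κ : ℝ} :
    κ ∈ principalCurvatures (frontier K) (gaussParam (frontier K) x) ↔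
      ∃ v, inner ℝ x v = (0 : ℝ) ∧ v ≠ 0 ∧
        fderiv ℝ (gaussParam (frontier K)) x v = κ⁻¹ • v := by
  have hpos := hcurv (gaussParam (frontier K) x) (by
    rw [gaussParam_of_norm_eq_one _ hx]; exact inverseGaussMap_mem hK hconv hne hreg hx)
  obtain ⟨S, hS, hsurj, hsymm, hinv, hpc⟩ := exists_shapeOperator hK hconv hne hreg hcurv hx
  set W := fderiv ℝ (gaussParam (frontier K)) x
  constructor
  · intro hκ
    have hκ0 := hpos κ hκ
    obtain ⟨v, hv, hv0, hSv⟩ := (hpc κ).1 hκ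
    refine ⟨v, hv, hv0, ?_⟩
    have h1 := hinv v hv
    rw [hSv, map_smul] at h1
    conv_rhs => rw [← h1]
    rw [smul_smul, inv_mul_cancel₀ hκ0.ne', one_smul]
  · rintro ⟨v, hv, hv0, hWv⟩
    obtain ⟨u, hu, rfl⟩ := hsurj v hv
    rw [hinv u hu] at hWv
    have hu0 : u ≠ 0 := by rintro rfl; simp at hv0
    -- For `κ = 0` the convention `0⁻¹ = 0` would put `v` in the kernel of `W`, where no nonzero
    -- tangent vector lies.
    have hκ0 : κ ≠ 0 := by rintro rfl; simp at hWv; exact hu0 hWv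
    refine (hpc κ).2 ⟨u, hu, hu0, ?_⟩
    conv_rhs => rw [hWv]
    rw [smul_smul, mul_inv_cancel₀ hκ0, one_smul]

lemma principalCurvatures_gaussParam {x a b : Space3} (hf : IsFrame x a b) :
    ‖(planarForm (fderiv ℝ (gaussParam (frontier K)) x) a b).2‖ <
        (planarForm (fderiv ℝ (gaussParam (frontier K)) x) a b).1 ∧
      principalCurvatures (frontier K) (gaussParam (frontier K) x) =
        {((planarForm (fderiv ℝ (gaussParam (frontier K)) x) a b).1 +
          ‖(planarForm (fderiv ℝ (gaussParam (frontier K)) x) a b).2‖)⁻¹,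
        ((planarForm (fderiv ℝ (gaussParam (frontier K)) x) a b).1 -
          ‖(planarForm (fderiv ℝ (gaussParam (frontier K)) x) a b).2‖)⁻¹} := by
  have hx0 := ne_zero_of_norm_eq_one hf.norm_x
  have hpos := hcurv (gaussParam (frontier K) x) (by
    rw [gaussParam_of_norm_eq_one _ hf.norm_x]
    exact inverseGaussMap_mem hK hconv hne hreg hf.norm_x)
  have hiff : ∀ κ, κ ∈ principalCurvatures (frontier K) (gaussParam (frontier K) x) ↔ _ :=
    fun κ => (mem_principalCurvatures_gaussParam hK hconv hne hreg hcurv hf.norm_x).trans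
      (hf.eigenvalue_iff (fun u v => fderiv_gaussParam_symm hK hconv hne hreg hcurv hx0 u v)
        (fderiv_gaussParam_self hK hconv hne hreg hcurv hx0))
  set m := (planarForm (fderiv ℝ (gaussParam (frontier K)) x) a b).1
  set ρ := ‖(planarForm (fderiv ℝ (gaussParam (frontier K)) x) a b).2‖
  constructor
  · have h1 := hpos (m - ρ)⁻¹ ((hiff _).2 (Or.inr (inv_inv _)))
    have := inv_pos.1 h1
    linarith
  · ext κ
    rw [hiff, mem_insert_iff, mem_singleton_iff, inv_eq_iff_eq_inv, inv_eq_iff_eq_inv]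

lemma isTangentiallyPositive_gaussParam : IsTangentiallyPositive (gaussParam (frontier K)) := by
  intro x a hx hxa ha
  obtain ⟨b, hf⟩ := exists_isFrame (a := ‖a‖⁻¹ • a) hx (norm_inv_norm_smul ha)
    (by rw [real_inner_smul_right, hxa, mul_zero])
  have h1 := (principalCurvatures_gaussParam hK hconv hne hreg hcurv hf).1
  have h2 := (abs_le.1 (Complex.abs_re_le_norm
    (planarForm (fderiv ℝ (gaussParam (frontier K)) x) (‖a‖⁻¹ • a) b).2)).1
  have h3 : 0 < (inner ℝ (fderiv ℝ (gaussParam (frontier K)) x (‖a‖⁻¹ • a)) (‖a‖⁻¹ • a) : ℝ) := by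
    simp only [planarForm, formPart] at h1 h2 ⊢
    linarith
  rw [map_smul, real_inner_smul_left, real_inner_smul_right, ← mul_assoc] at h3
  exact pos_of_mul_pos_right h3 (by positivity)

/-- Inversion reverses the order: the larger curvature belongs to the smaller radius. -/
lemma kappa_gaussParam {x a b : Space3} (hf : IsFrame x a b) :
    kappa1 (frontier K) (inverseGaussMap (frontier K) x) =
      ((planarForm (fderiv ℝ (gaussParam (frontier K)) x) a b).1 -
          ‖(planarForm (fderiv ℝ (gaussParam (frontier K)) x) a b).2‖)⁻¹ ∧
    kappa2 (frontier K) (inverseGaussMap (frontier K) x) =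
      ((planarForm (fderiv ℝ (gaussParam (frontier K)) x) a b).1 +
          ‖(planarForm (fderiv ℝ (gaussParam (frontier K)) x) a b).2‖)⁻¹ := by
  obtain ⟨h1, h2⟩ := principalCurvatures_gaussParam hK hconv hne hreg hcurv hf
  rw [← gaussParam_of_norm_eq_one _ hf.norm_x, kappa1, kappa2, h2, csSup_pair, csInf_pair]
  have h0 := norm_nonneg (planarForm (fderiv ℝ (gaussParam (frontier K)) x) a b).2
  have hle : ((planarForm (fderiv ℝ (gaussParam (frontier K)) x) a b).1 +
          ‖(planarForm (fderiv ℝ (gaussParam (frontier K)) x) a b).2‖)⁻¹ ≤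
      ((planarForm (fderiv ℝ (gaussParam (frontier K)) x) a b).1 -
          ‖(planarForm (fderiv ℝ (gaussParam (frontier K)) x) a b).2‖)⁻¹ :=
    inv_anti₀ (by linarith) (by linarith)
  exact ⟨sup_of_le_right hle, inf_of_le_left hle⟩

end

/-! ### Curvature functions as elliptic functions of the radii. -/

/-- A symmetric curvature function which is decreasing in both principal curvatures is elliptic
as a function of the principal radii. -/
lemma isEllipticRadial_of_neg {F : ℝ × ℝ → ℝ} (hF : ContDiffOn ℝ 2 F (Ioi 0 ×ˢ Ioi 0))
    (hsymm : ∀ y₁ > 0, ∀ y₂ > 0, F (y₁, y₂) = F (y₂, y₁))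
    (h₁ : ∀ y ∈ Ioi (0 : ℝ) ×ˢ Ioi (0 : ℝ), fderiv ℝ F y (1, 0) < 0)
    (h₂ : ∀ y ∈ Ioi (0 : ℝ) ×ˢ Ioi (0 : ℝ), fderiv ℝ F y (0, 1) < 0) :
    IsEllipticRadial fun p => F ((p.1 - p.2)⁻¹, (p.1 + p.2)⁻¹) := by
  have hpos : ∀ p : ℝ × ℝ, |p.2| < p.1 → 0 < p.1 - p.2 ∧ 0 < p.1 + p.2 := fun p hp => by
    have := abs_lt.1 hp
    constructor <;> linarith
  have hmem : ∀ p : ℝ × ℝ, |p.2| < p.1 →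
      ((p.1 - p.2)⁻¹, (p.1 + p.2)⁻¹) ∈ Ioi (0 : ℝ) ×ˢ Ioi (0 : ℝ) := fun p hp =>
    ⟨inv_pos.2 (hpos p hp).1, inv_pos.2 (hpos p hp).2⟩
  refine ⟨?_, fun m q hq => ?_, fun p hp => ?_⟩
  · refine hF.comp (f := fun p : ℝ × ℝ => ((p.1 - p.2)⁻¹, (p.1 + p.2)⁻¹)) ?_ hmem
    exact ((contDiffOn_fst.sub contDiffOn_snd).inv fun p hp => (hpos p hp).1.ne').prodMk
      ((contDiffOn_fst.add contDiffOn_snd).inv fun p hp => (hpos p hp).2.ne')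
  · obtain ⟨h1, h2⟩ := hmem (m, q) hq
    simp only [sub_neg_eq_add, ← sub_eq_add_neg]
    exact hsymm _ h2 _ h1
  · obtain ⟨ha, hb⟩ := hpos p hp
    set y : ℝ × ℝ := ((p.1 - p.2)⁻¹, (p.1 + p.2)⁻¹) with hy
    have hyQ := hmem p hp
    have hFd : HasFDerivAt F (fderiv ℝ F y) y :=
      ((hF.contDiffAt ((isOpen_Ioi.prod isOpen_Ioi).mem_nhds hyQ)).differentiableAt
        two_ne_zero).hasFDerivAt
    have hsub : HasFDerivAt (fun p : ℝ × ℝ => p.1 - p.2)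
        (ContinuousLinearMap.fst ℝ ℝ ℝ - ContinuousLinearMap.snd ℝ ℝ ℝ) p :=
      hasFDerivAt_fst.sub hasFDerivAt_snd
    have hadd : HasFDerivAt (fun p : ℝ × ℝ => p.1 + p.2)
        (ContinuousLinearMap.fst ℝ ℝ ℝ + ContinuousLinearMap.snd ℝ ℝ ℝ) p :=
      hasFDerivAt_fst.add hasFDerivAt_snd
    have e1 := (hasDerivAt_inv ha.ne').comp_hasFDerivAt p hsub
    have e2 := (hasDerivAt_inv hb.ne').comp_hasFDerivAt p hadd
    have hsplit : ∀ s t : ℝ, fderiv ℝ F y (s, t) =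
        s * fderiv ℝ F y (1, 0) + t * fderiv ℝ F y (0, 1) := fun s t => by
      have : (s, t) = s • ((1 : ℝ), (0 : ℝ)) + t • ((0 : ℝ), (1 : ℝ)) := by ext <;> simp
      rw [this, map_add, map_smul, map_smul, smul_eq_mul, smul_eq_mul]
    have hG := (hFd.comp p (e1.prodMk e2)).fderiv
    have hGm : fderiv ℝ (fun p : ℝ × ℝ => F ((p.1 - p.2)⁻¹, (p.1 + p.2)⁻¹)) p (1, 0) =
        -((p.1 - p.2) ^ 2)⁻¹ * fderiv ℝ F y (1, 0) +
          -((p.1 + p.2) ^ 2)⁻¹ * fderiv ℝ F y (0, 1) := by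
      rw [← hsplit]
      refine (DFunLike.congr_fun hG _).trans ?_
      simp
    have hGq : fderiv ℝ (fun p : ℝ × ℝ => F ((p.1 - p.2)⁻¹, (p.1 + p.2)⁻¹)) p (0, 1) =
        ((p.1 - p.2) ^ 2)⁻¹ * fderiv ℝ F y (1, 0) +
          -((p.1 + p.2) ^ 2)⁻¹ * fderiv ℝ F y (0, 1) := by
      rw [← hsplit]
      refine (DFunLike.congr_fun hG _).trans ?_
      simp
    -- The sum and the difference of the two derivatives just computed are `-2 (p.1 + p.2)⁻² ∂₂F`
    -- and `-2 (p.1 - p.2)⁻² ∂₁F`, both positive.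
    have h3 := mul_neg_of_pos_of_neg (inv_pos.2 (pow_pos ha 2)) (h₁ y hyQ)
    have h4 := mul_neg_of_pos_of_neg (inv_pos.2 (pow_pos hb 2)) (h₂ y hyQ)
    rw [hGm, hGq, abs_lt]
    constructor <;> linarith

/-- Every admissible curvature function becomes elliptic after multiplication by a sign. -/
lemma exists_sign_isEllipticRadial {f : ℝ → ℝ → ℝ}
    (hf : ContDiffOn ℝ 2 (fun y : ℝ × ℝ => f y.1 y.2) (Ioi 0 ×ˢ Ioi 0))
    (hsymm : ∀ y₁ > 0, ∀ y₂ > 0, f y₁ y₂ = f y₂ y₁)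
    (hderiv : ∀ y₁ > 0, ∀ y₂ > 0,
      0 < deriv (fun s => f s y₂) y₁ * deriv (fun s => f y₁ s) y₂) :
    ∃ ε : ℝ, IsEllipticRadial fun p => ε * f (p.1 - p.2)⁻¹ (p.1 + p.2)⁻¹ := by
  set F : ℝ × ℝ → ℝ := fun y => f y.1 y.2
  set Q : Set (ℝ × ℝ) := Ioi 0 ×ˢ Ioi 0
  have hQ : IsOpen Q := isOpen_Ioi.prod isOpen_Ioi
  have hFd : ∀ y ∈ Q, HasFDerivAt F (fderiv ℝ F y) y := fun y hy =>
    ((hf.contDiffAt (hQ.mem_nhds hy)).differentiableAt two_ne_zero).hasFDerivAt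
  have hprod : ∀ y ∈ Q, 0 < fderiv ℝ F y (1, 0) * fderiv ℝ F y (0, 1) := fun y hy => by
    have h1 : HasDerivAt (fun s => f s y.2) (fderiv ℝ F y (1, 0)) y.1 :=
      (hFd y hy).comp_hasDerivAt (f := fun s => (s, y.2)) y.1 ((hasDerivAt_id y.1).prodMk (hasDerivAt_const y.1 y.2))
    have h2 : HasDerivAt (fun s => f y.1 s) (fderiv ℝ F y (0, 1)) y.2 :=
      (hFd y hy).comp_hasDerivAt (f := fun s => (y.1, s)) y.2 ((hasDerivAt_const y.2 y.1).prodMk (hasDerivAt_id y.2))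
    rw [← h1.deriv, ← h2.deriv]
    exact hderiv y.1 hy.1 y.2 hy.2
  have hc : ContinuousOn (fun y => fderiv ℝ F y (1, 0)) Q :=
    (hf.fderiv_of_isOpen (m := 1) hQ (by norm_num)).continuousOn.clm_apply continuousOn_const
  have hconn : IsPreconnected Q := ((convex_Ioi (0 : ℝ)).prod (convex_Ioi 0)).isPreconnected
  -- The first partial derivative has no zero on the connected quadrant, hence a constant sign, and
  -- the second partial derivative shares it.
  have hsign : (∀ y ∈ Q, fderiv ℝ F y (1, 0) < 0) ∨ ∀ y ∈ Q, 0 < fderiv ℝ F y (1, 0) := by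
    by_contra! hcon
    obtain ⟨⟨y, hy, h1⟩, y', hy', h2⟩ := hcon
    obtain ⟨z, hz, hz0⟩ := hconn.intermediate_value hy' hy hc ⟨h2, h1⟩
    have := hprod z hz
    simp only at hz0
    rw [hz0, zero_mul] at this
    exact this.false
  rcases hsign with h | h
  · refine ⟨1, ?_⟩
    simp only [one_mul]
    exact isEllipticRadial_of_neg hf hsymm h fun y hy =>
      neg_of_mul_pos_right (hprod y hy) (h y hy).le
  · refine ⟨-1, ?_⟩
    simp only [neg_one_mul]
    have hneg : ∀ y ∈ Q, fderiv ℝ (fun y => -F y) y = -fderiv ℝ F y := fun y _ => fderiv_fun_neg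
    refine isEllipticRadial_of_neg (F := fun y => -F y) hf.neg
      (fun y₁ h1 y₂ h2 => congrArg Neg.neg (hsymm y₁ h1 y₂ h2)) (fun y hy => ?_) fun y hy => ?_
    · rw [hneg y hy]
      exact neg_neg_of_pos (h y hy)
    · rw [hneg y hy]
      exact neg_neg_of_pos (pos_of_mul_pos_right (hprod y hy) (h y hy).le)

/-! ### Conclusion for surfaces. -/

theorem corollaryC3 (f : ℝ → ℝ → ℝ)
    (hf : ContDiffOn ℝ 2 (fun y : ℝ × ℝ => f y.1 y.2) (Ioi 0 ×ˢ Ioi 0))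
    (hsymm : ∀ y₁ > 0, ∀ y₂ > 0, f y₁ y₂ = f y₂ y₁)
    (hderiv : ∀ y₁ > 0, ∀ y₂ > 0,
      0 < deriv (fun s => f s y₂) y₁ * deriv (fun s => f y₁ s) y₂)
    (M₁ M₂ : Set Space3)
    (hM₁ : IsClosedStrictlyConvexSurface 3 M₁) (hM₂ : IsClosedStrictlyConvexSurface 3 M₂)
    (hmatch : ∀ x ∈ Metric.sphere (0 : Space3) 1,
      f (kappa1 M₁ (inverseGaussMap M₁ x)) (kappa2 M₁ (inverseGaussMap M₁ x)) =
        f (kappa1 M₂ (inverseGaussMap M₂ x)) (kappa2 M₂ (inverseGaussMap M₂ x))) :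
    ∃ a : Space3, M₂ = (fun y => y + a) '' M₁ := by
  obtain ⟨ε, hG⟩ := exists_sign_isEllipticRadial hf hsymm hderiv
  obtain ⟨⟨K₁, hK₁, hconv₁, hne₁, rfl⟩, hreg₁, hcurv₁⟩ := hM₁
  obtain ⟨⟨K₂, hK₂, hconv₂, hne₂, rfl⟩, hreg₂, hcurv₂⟩ := hM₂
  have heq : HaveEqualCurvature (fun p => ε * f (p.1 - p.2)⁻¹ (p.1 + p.2)⁻¹)
      (gaussParam (frontier K₁)) (gaussParam (frontier K₂)) := fun x a b hfr => by
    obtain ⟨h1, h2⟩ := kappa_gaussParam hK₁ hconv₁ hne₁ hreg₁ hcurv₁ hfr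
    obtain ⟨h3, h4⟩ := kappa_gaussParam hK₂ hconv₂ hne₂ hreg₂ hcurv₂ hfr
    have := hmatch x (by simpa using hfr.norm_x)
    rw [h1, h2, h3, h4] at this
    simp only [this]
  obtain ⟨c, hc⟩ := sub_eq_const hG
    (isSupportGradient_gaussParam hK₁ hconv₁ hne₁ hreg₁ hcurv₁)
    (isSupportGradient_gaussParam hK₂ hconv₂ hne₂ hreg₂ hcurv₂)
    (isTangentiallyPositive_gaussParam hK₁ hconv₁ hne₁ hreg₁ hcurv₁)
    (isTangentiallyPositive_gaussParam hK₂ hconv₂ hne₂ hreg₂ hcurv₂) heq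
  have hrel : ∀ x : Space3, ‖x‖ = 1 →
      inverseGaussMap (frontier K₂) x = inverseGaussMap (frontier K₁) x + -c := fun x hx => by
    rw [← hc x (ne_zero_of_norm_eq_one hx), Pi.sub_apply, gaussParam_of_norm_eq_one _ hx,
      gaussParam_of_norm_eq_one _ hx]
    abel
  -- Every point of a surface is the inverse Gauss image of its own normal, so the relation between
  -- the two parametrizations gives both inclusions.
  refine ⟨-c, Subset.antisymm (fun y hy => ?_) ?_⟩
  · have hn := (gaussMap_spec hK₂ hconv₂ hne₂ hreg₂ hy).1
    refine ⟨_, inverseGaussMap_mem hK₁ hconv₁ hne₁ hreg₁ hn, ?_⟩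
    simp only
    rw [← hrel _ hn, inverseGaussMap_gaussMap hK₂ hconv₂ hne₂ hreg₂ hcurv₂ hy]
  · rintro _ ⟨y, hy, rfl⟩
    have hn := (gaussMap_spec hK₁ hconv₁ hne₁ hreg₁ hy).1
    simp only
    rw [← inverseGaussMap_gaussMap hK₁ hconv₁ hne₁ hreg₁ hcurv₁ hy, ← hrel _ hn]
    exact inverseGaussMap_mem hK₂ hconv₂ hne₂ hreg₂ hn
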